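/- (i) There are infinitely many $r\in\mathbb{Q}$ such that, for each of them, there are infinitely many pairs of rational points $(x_1,y_1),(x_2,y_2)$ on the unit circle $x^2+y^2=1$ with $x_1\neq 0$ and $x_2/x_1=r^2$. (ii) More precisely, let $u\in\mathbb{Q}\setminus\{0,1,-1\}$, and let $H$ be the smooth projective model of the quartic $$w^2=-(u^4-1)r^4+(u^4-1)u^4,$$ regarded as an elliptic curve over $\mathbb{Q}$ with origin the rational point $(r,w)=(u,0)$. Then $P=(1,u^4-1)$ is a point of infinite order in $H(\mathbb{Q})$. For every integer $m\notin\{0,1,-1\}$ the multiple $mP$ is an affine point $(r,w)$ with $r\notin\{0,1,-1\}$; for this $r$ the point $(u^4,u^2w)$ is a rational point of infinite order on the elliptic curve $y^2=x(x-1)(x-r^4)$, and there are infinitely many pairs of rational points $(x_1,y_1),(x_2,y_2)$ on the unit circle with $x_1\ne0$ and $x_2/x_1=r^2$. The set of the $r$-coordinates of the points $mP$, $m\in\mathbb{Z}\setminus\{0,1,-1\}$, is infinite. -/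

import Mathlib

/-- The pairs of rational points `((x₁, y₁), (x₂, y₂))` on the unit circle `x ^ 2 + y ^ 2 = 1`
whose abscissae satisfy `x₂ / x₁ = ρ`. -/
def circlePairs (ρ : ℚ) : Set ((ℚ × ℚ) × (ℚ × ℚ)) :=
  {p | p.1.1 ^ 2 + p.1.2 ^ 2 = 1 ∧ p.2.1 ^ 2 + p.2.2 ^ 2 = 1 ∧ p.1.1 ≠ 0 ∧ p.2.1 / p.1.1 = ρ}

/-- The Legendre curve `y ^ 2 = x (x - 1) (x - r ^ 4)`. -/
def legendreCurve (r : ℚ) : WeierstrassCurve.Affine ℚ where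
  a₁ := 0
  a₂ := -(1 + r ^ 4)
  a₃ := 0
  a₄ := r ^ 4
  a₆ := 0

theorem legendreCurve_equation_iff (r x y : ℚ) :
    (legendreCurve r).Equation x y ↔ y ^ 2 = x * (x - 1) * (x - r ^ 4) := by
  rw [WeierstrassCurve.Affine.equation_iff]
  simp only [legendreCurve]
  constructor <;> intro h <;> linear_combination h

/-- The parameters `u` for which the quartic below is a curve of genus one. -/
def Admissible (u : ℚ) : Prop := u ≠ 0 ∧ u ≠ 1 ∧ u ≠ -1

theorem Admissible.sub_ne_zero {u : ℚ} (hu : Admissible u) : u ^ 4 - 1 ≠ 0 := by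
  obtain ⟨-, h1, h2⟩ := hu
  have h : u ^ 4 - 1 = (u - 1) * (u + 1) * (u ^ 2 + 1) := by ring
  rw [h]
  refine mul_ne_zero (mul_ne_zero (_root_.sub_ne_zero.2 h1) ?_) (by positivity)
  intro h3
  exact h2 (by linarith)

/-- The rational points of the smooth projective model of the quartic
`w ^ 2 = -(u ^ 4 - 1) * r ^ 4 + (u ^ 4 - 1) * u ^ 4` for an admissible `u`: the affine points
`(r, w)`, and the points at infinity, at which `w / r ^ 2` takes a value `s` with
`s ^ 2 = -(u ^ 4 - 1)`. -/
inductive QuarticPoint (u : ℚ) : Type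
  | affine (r w : ℚ) (h : w ^ 2 = -(u ^ 4 - 1) * r ^ 4 + (u ^ 4 - 1) * u ^ 4) : QuarticPoint u
  | infinity (s : ℚ) (h : s ^ 2 = -(u ^ 4 - 1)) : QuarticPoint u

/-- The Weierstrass model `y ^ 2 = x ^ 3 + 4 * (u ^ 2 * (u ^ 4 - 1)) ^ 2 * x` of the quartic. -/
def quarticModel (u : ℚ) : WeierstrassCurve.Affine ℚ where
  a₁ := 0
  a₂ := 0
  a₃ := 0
  a₄ := 4 * (u ^ 2 * (u ^ 4 - 1)) ^ 2
  a₆ := 0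

theorem quarticModel_equation_iff (u x y : ℚ) :
    (quarticModel u).Equation x y ↔ y ^ 2 = x ^ 3 + 4 * (u ^ 2 * (u ^ 4 - 1)) ^ 2 * x := by
  rw [WeierstrassCurve.Affine.equation_iff]
  simp only [quarticModel]
  constructor <;> intro h <;> linear_combination h

theorem quarticModel_nonsingular {u : ℚ} (hu : Admissible u) {x y : ℚ}
    (h : y ^ 2 = x ^ 3 + 4 * (u ^ 2 * (u ^ 4 - 1)) ^ 2 * x) :
    (quarticModel u).Nonsingular x y := by
  rw [← WeierstrassCurve.Affine.equation_iff_nonsingular_of_Δ_ne_zero]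
  · exact (quarticModel_equation_iff u x y).2 h
  · have h1 := hu.1
    have h2 := hu.sub_ne_zero
    have h3 : (quarticModel u).Δ = -64 * (4 * (u ^ 2 * (u ^ 4 - 1)) ^ 2) ^ 3 := by
      simp only [quarticModel, WeierstrassCurve.Δ, WeierstrassCurve.b₂, WeierstrassCurve.b₄,
        WeierstrassCurve.b₆, WeierstrassCurve.b₈]
      ring
    rw [h3]
    positivity

namespace QuarticPoint

variable {u : ℚ}

theorem affine_ext {r w r' w' : ℚ} {h h'} (hr : r = r') (hw : w = w') :
    (affine r w h : QuarticPoint u) = affine r' w' h' := by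
  subst hr hw
  rfl

/-- The isomorphism of curves that sends the point `(u, 0)` of the quartic to the point at infinity
of the Weierstrass model, and a point `(r, w)` with `r ≠ u` to
`(2 * u ^ 2 * (u ^ 4 - 1) * (u + r) / (u - r), 4 * u ^ 3 * (u ^ 4 - 1) * w / (u - r) ^ 2)`. -/
def toModel (hu : Admissible u) : QuarticPoint u → (quarticModel u).Point
  | affine r w h =>
    if hr : r = u then 0
    else .some (2 * u ^ 2 * (u ^ 4 - 1) * (u + r) / (u - r))
      (4 * u ^ 3 * (u ^ 4 - 1) * w / (u - r) ^ 2)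
      (quarticModel_nonsingular hu (by
        have h1 : u - r ≠ 0 := sub_ne_zero.2 (Ne.symm hr)
        rw [div_pow, mul_pow, h]
        generalize u ^ 4 - 1 = A
        field_simp
        ring))
  | infinity s h => .some (-(2 * u ^ 2 * (u ^ 4 - 1))) (4 * u ^ 3 * (u ^ 4 - 1) * s)
      (quarticModel_nonsingular hu (by
        rw [mul_pow, h]
        ring))

/-- The inverse of `toModel`. -/
def ofModel (hu : Admissible u) : (quarticModel u).Point → QuarticPoint u
  | .zero => affine u 0 (by ring)
  | .some x y h =>
    if hx : x = -(2 * u ^ 2 * (u ^ 4 - 1)) then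
      infinity (y / (4 * u ^ 3 * (u ^ 4 - 1))) (by
        have h1 := hu.1
        have h2 := hu.sub_ne_zero
        have h3 := (quarticModel_equation_iff u x y).1 h.1
        rw [div_pow, h3, hx]
        generalize u ^ 4 - 1 = A at *
        field_simp
        ring)
    else
      affine (u * (x - 2 * u ^ 2 * (u ^ 4 - 1)) / (x + 2 * u ^ 2 * (u ^ 4 - 1)))
        (4 * u ^ 3 * (u ^ 4 - 1) * y / (x + 2 * u ^ 2 * (u ^ 4 - 1)) ^ 2) (by
        have h1 : x + 2 * u ^ 2 * (u ^ 4 - 1) ≠ 0 := fun h0 => hx (by linarith)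
        have h3 := (quarticModel_equation_iff u x y).1 h.1
        rw [div_pow, mul_pow, h3]
        clear h h3 hx
        generalize u ^ 4 - 1 = A at *
        obtain ⟨D, rfl⟩ : ∃ D, x = D - 2 * u ^ 2 * A := ⟨x + 2 * u ^ 2 * A, by ring⟩
        have hD : D - 2 * u ^ 2 * A + 2 * u ^ 2 * A = D := by ring
        rw [hD] at h1 ⊢
        field_simp
        ring)

theorem ofModel_toModel (hu : Admissible u) (p : QuarticPoint u) :
    ofModel hu (toModel hu p) = p := by
  have h1 := hu.1
  have h2 := hu.sub_ne_zero
  cases p with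
  | affine r w h =>
    by_cases hr : r = u
    · subst hr
      have hw : w = 0 := by
        have h0 : w ^ 2 = 0 := by rw [h]; ring
        exact pow_eq_zero_iff (two_ne_zero) |>.1 h0
      simp only [toModel, dif_pos]
      exact affine_ext rfl hw.symm
    · have h3 : u - r ≠ 0 := sub_ne_zero.2 (Ne.symm hr)
      have h4 : 2 * u ^ 2 * (u ^ 4 - 1) * (u + r) / (u - r) + 2 * u ^ 2 * (u ^ 4 - 1)
          = 4 * u ^ 3 * (u ^ 4 - 1) / (u - r) := by
        generalize u ^ 4 - 1 = A at *
        field_simp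
        ring
      have h5 : 2 * u ^ 2 * (u ^ 4 - 1) * (u + r) / (u - r) ≠ -(2 * u ^ 2 * (u ^ 4 - 1)) := by
        intro h6
        have h7 : 4 * u ^ 3 * (u ^ 4 - 1) / (u - r) = 0 := by rw [← h4, h6]; ring
        have h8 : 4 * u ^ 3 * (u ^ 4 - 1) / (u - r) ≠ 0 := by positivity
        exact h8 h7
      simp only [toModel, dif_neg hr, ofModel, dif_neg h5]
      refine affine_ext ?_ ?_
      · rw [h4]
        clear h h4 h5
        generalize u ^ 4 - 1 = A at *
        field_simp
        ring
      · rw [h4]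
        clear h h4 h5
        generalize u ^ 4 - 1 = A at *
        field_simp
        try ring
  | infinity s h =>
    simp only [toModel, ofModel, dif_pos]
    congr 1
    clear h
    generalize u ^ 4 - 1 = A at *
    field_simp

theorem toModel_ofModel (hu : Admissible u) (q : (quarticModel u).Point) :
    toModel hu (ofModel hu q) = q := by
  have h1 := hu.1
  have h2 := hu.sub_ne_zero
  cases q with
  | zero => simp only [ofModel, toModel, dif_pos]; rfl
  | some x y h =>
    by_cases hx : x = -(2 * u ^ 2 * (u ^ 4 - 1))
    · simp only [ofModel, dif_pos hx, toModel]
      rw [WeierstrassCurve.Affine.Point.some.injEq]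
      refine ⟨hx.symm, ?_⟩
      clear hx
      generalize u ^ 4 - 1 = A at *
      field_simp
    · have h3 : x + 2 * u ^ 2 * (u ^ 4 - 1) ≠ 0 := fun h0 => hx (by linarith)
      have h4 : u - u * (x - 2 * u ^ 2 * (u ^ 4 - 1)) / (x + 2 * u ^ 2 * (u ^ 4 - 1))
          = 4 * u ^ 3 * (u ^ 4 - 1) / (x + 2 * u ^ 2 * (u ^ 4 - 1)) := by
        clear h hx
        generalize u ^ 4 - 1 = A at *
        obtain ⟨D, rfl⟩ : ∃ D, x = D - 2 * u ^ 2 * A := ⟨x + 2 * u ^ 2 * A, by ring⟩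
        have hD : D - 2 * u ^ 2 * A + 2 * u ^ 2 * A = D := by ring
        rw [hD] at h3 ⊢
        field_simp
        ring
      have h5 : u * (x - 2 * u ^ 2 * (u ^ 4 - 1)) / (x + 2 * u ^ 2 * (u ^ 4 - 1)) ≠ u := by
        intro h6
        have h7 : 4 * u ^ 3 * (u ^ 4 - 1) / (x + 2 * u ^ 2 * (u ^ 4 - 1)) = 0 := by
          rw [← h4, h6]; ring
        have h8 : 4 * u ^ 3 * (u ^ 4 - 1) / (x + 2 * u ^ 2 * (u ^ 4 - 1)) ≠ 0 := by positivity
        exact h8 h7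
      simp only [ofModel, dif_neg hx, toModel, dif_neg h5]
      rw [WeierstrassCurve.Affine.Point.some.injEq]
      constructor
      · rw [h4]
        clear h hx h4 h5
        generalize u ^ 4 - 1 = A at *
        obtain ⟨D, rfl⟩ : ∃ D, x = D - 2 * u ^ 2 * A := ⟨x + 2 * u ^ 2 * A, by ring⟩
        have hD : D - 2 * u ^ 2 * A + 2 * u ^ 2 * A = D := by ring
        rw [hD] at h3 ⊢
        field_simp
        ring
      · rw [h4]
        clear h hx h4 h5
        generalize u ^ 4 - 1 = A at *
        obtain ⟨D, rfl⟩ : ∃ D, x = D - 2 * u ^ 2 * A := ⟨x + 2 * u ^ 2 * A, by ring⟩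
        have hD : D - 2 * u ^ 2 * A + 2 * u ^ 2 * A = D := by ring
        rw [hD] at h3 ⊢
        field_simp
        try ring

/-- The rational points of the quartic and those of its Weierstrass model correspond bijectively. -/
def equivModel (hu : Admissible u) : QuarticPoint u ≃ (quarticModel u).Point where
  toFun := toModel hu
  invFun := ofModel hu
  left_inv := ofModel_toModel hu
  right_inv := toModel_ofModel hu

/-- The group law of the quartic as an elliptic curve with origin `(u, 0)`, which is the law that
an isomorphism onto a Weierstrass model carrying `(u, 0)` to the point at infinity transports. -/
instance [hu : Fact (Admissible u)] : AddCommGroup (QuarticPoint u) :=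
  (equivModel hu.out).addCommGroup

theorem zero_eq [Fact (Admissible u)] : (0 : QuarticPoint u) = affine u 0 (by ring) := rfl

/-- The point `(r, w) = (1, u ^ 4 - 1)` of the quartic. -/
def base (u : ℚ) : QuarticPoint u :=
  affine 1 (u ^ 4 - 1) (by ring)

end QuarticPoint

/-! If `x`, `x - 1` and `x - r ^ 4` are nonzero-denominator squares `s ^ 2`, `t ^ 2`, `v ^ 2` with
`s ≠ 0`, then `(1 / s, t / s)` and `(r ^ 2 / s, v / s)` lie on the circle and have ratio `r ^ 2`.
Doubles on the Legendre curve of `r ^ 4` have such abscissae, so one point of infinite order there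
is enough. The point `(u ^ 4, u ^ 2 * w)` lies on that curve whenever `(r, w)` lies on the quartic.

Two torsion statements remain. Both rest on Fermat's theorem that a difference of two fourth powers
is not a nontrivial square, and on the integrality of torsion abscissae
(`padicNorm_le_of_isOfFinAddOrder`), which comes from expanding the local parameter `g ^ 2 / x`
along the multiples of a point near infinity.

The quartic is `y ^ 2 = x ^ 3 + 4 * c ^ 2 * x` with `c = u ^ 2 * (u ^ 4 - 1)`, and neither `c` nor
`-c` is a square. For a torsion point with `2P ≠ 0`, integrality of `2P`, `4P`, `8P` at odd primes
forces `x(4P) = ±2c`, which is impossible. So the base point, not being killed by two, has infinite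
order.

On the Legendre curve there is no point of order four, so a torsion point `Q = (u ^ 4, u ^ 2 * w)`
becomes a double after adding a 2-torsion point, which imposes a square condition. Integrality of
`Q` and `2Q` at odd primes makes `(u ^ 4 - 1) / (u ^ 4 - r ^ 4)` a power of four times a fourth
power. Together these give `4 ^ k * a ^ 4 - b ^ 4 = ±z ^ 2`, against Fermat. -/

/-! ### Fermat's descent for fourth powers and squares. -/

/-- The Pythagorean triple `(j ^ 2, 2 * i ^ 2, |x|)` has coprime parameters `a`, `b` with product `i
^ 2`, so both are squares up to sign, and `j ^ 2 = a ^ 2 - b ^ 2`. This closes the descent below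
when `y` is even. -/
theorem exists_sq_eq_four_sub_four {i j x : ℤ} (hi : i ≠ 0) (hij : IsCoprime j i)
    (hj2 : j % 2 = 1) (h : x ^ 2 = 4 * i ^ 4 + j ^ 4) :
    ∃ A B : ℤ, B ≠ 0 ∧ j ^ 2 = A ^ 4 - B ^ 4 ∧ A.natAbs < x.natAbs := by
  have hj2' : j ^ 2 % 2 = 1 := by rw [sq, Int.mul_emod, hj2]; decide
  have hx : 0 < |x| := by
    rw [abs_pos]
    rintro rfl
    have : 0 < i ^ 4 := by positivity
    nlinarith [sq_nonneg (j ^ 2)]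
  have ht : PythagoreanTriple (j ^ 2) (2 * i ^ 2) |x| := by
    delta PythagoreanTriple
    rw [abs_mul_abs_self]
    linear_combination -h
  have h2 : IsCoprime j 2 := by
    refine ⟨1, -(j / 2), ?_⟩
    have := Int.emod_add_mul_ediv j 2
    linarith
  have hc : Int.gcd (j ^ 2) (2 * i ^ 2) = 1 :=
    Int.isCoprime_iff_gcd_eq_one.1 (IsCoprime.mul_right h2.pow_left hij.pow)
  obtain ⟨a, b, h3, h4, h5, h6, -, h7⟩ := ht.coprime_classification' hc hj2' hx
  have h8 : a * b = i ^ 2 := by linarith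
  have hb0 : b ≠ 0 := by
    rintro rfl
    exact hi (by simpa using h8.symm)
  have h9 : b * a = i ^ 2 := by linarith
  obtain ⟨A, hA⟩ := Int.sq_of_gcd_eq_one h6 h8
  obtain ⟨B, hB⟩ := Int.sq_of_gcd_eq_one (by rwa [Int.gcd_comm]) h9
  have hA2 : a ^ 2 = A ^ 4 := by rcases hA with h | h <;> rw [h] <;> ring
  have hB2 : b ^ 2 = B ^ 4 := by rcases hB with h | h <;> rw [h] <;> ring
  refine ⟨A, B, ?_, by rw [h3, hA2, hB2], ?_⟩
  · rintro rfl
    apply hb0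
    simpa using hB
  · zify
    rw [h5, hA2]
    have h10 : 0 < b ^ 2 := by positivity
    have h11 : |A| ≤ A ^ 4 := by
      have h12 : |A| ≤ |A| ^ 4 := by
        rcases eq_or_ne A 0 with rfl | h
        · simp
        · exact le_self_pow₀ (Int.one_le_abs h) (by norm_num)
      rwa [Even.pow_abs (by decide)] at h12
    linarith

/-- Descent on `|x|`. Common primes are divided out. For odd `y`, the parameters of the triple `(y ^
2, z, x ^ 2)` satisfy `m ^ 4 - k ^ 4 = (x * y) ^ 2`. For even `y`, those of `(z, y ^ 2, x ^ 2)` give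
`x ^ 2 = 4 * i ^ 4 + j ^ 4`. -/
theorem Int.four_sub_four_ne_sq (n : ℕ) : ∀ {x y z : ℤ}, x.natAbs = n → y ≠ 0 → z ≠ 0 →
    x ^ 4 - y ^ 4 ≠ z ^ 2 := by
  induction n using Nat.strong_induction_on with
  | _ n ih =>
  intro x y z hn hy hz h
  have hx : x ≠ 0 := by
    rintro rfl
    have h1 : 0 < y ^ 4 := by positivity
    nlinarith [sq_nonneg z]
  by_cases hc : IsCoprime x y
  swap
  · rw [Int.isCoprime_iff_gcd_eq_one] at hc
    obtain ⟨p, hp, hpx, hpy⟩ := Nat.Prime.not_coprime_iff_dvd.1 hc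
    obtain ⟨x', rfl⟩ := Int.natCast_dvd.2 hpx
    obtain ⟨y', rfl⟩ := Int.natCast_dvd.2 hpy
    have h1 : ((p : ℤ) ^ 2) ^ 2 ∣ z ^ 2 := ⟨x' ^ 4 - y' ^ 4, by linear_combination -h⟩
    obtain ⟨z', rfl⟩ := (Int.pow_dvd_pow_iff two_ne_zero).1 h1
    have hp0 : (p : ℤ) ≠ 0 := by exact_mod_cast hp.ne_zero
    refine ih x'.natAbs ?_ rfl (right_ne_zero_of_mul hy) (right_ne_zero_of_mul hz)
      (mul_left_cancel₀ (pow_ne_zero 4 hp0) (by linear_combination h))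
    rw [← hn, Int.natAbs_mul, Int.natAbs_natCast]
    have : 0 < x'.natAbs := Int.natAbs_pos.2 (right_ne_zero_of_mul hx)
    nlinarith [hp.two_le]
  · have hx2 : 0 < x ^ 2 := by positivity
    have hcz : IsCoprime (y ^ 2) z := by
      have h1 : IsCoprime (y ^ 4) (z ^ 2) := by
        have h2 : z ^ 2 = x ^ 4 + y ^ 4 * (-1) := by linear_combination -h
        rw [h2]
        exact IsCoprime.add_mul_left_right hc.symm.pow (-1)
      have h3 : IsCoprime ((y ^ 2) ^ 2) (z ^ 2) := by
        rwa [← pow_mul]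
      exact (IsCoprime.pow_iff (by norm_num) (by norm_num)).1 h3
    rcases Int.emod_two_eq_zero_or_one y with hy2 | hy2
    · have hz2 : z % 2 = 1 := by
        rcases Int.emod_two_eq_zero_or_one z with hz2 | hz2
        · exfalso
          have h1 : IsUnit (2 : ℤ) := hcz.isUnit_of_dvd'
            (dvd_pow (Int.dvd_of_emod_eq_zero hy2) two_ne_zero) (Int.dvd_of_emod_eq_zero hz2)
          exact absurd h1 (by decide)
        · exact hz2
      have ht : PythagoreanTriple z (y ^ 2) (x ^ 2) := by
        delta PythagoreanTriple
        linear_combination -h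
      obtain ⟨m, k, h3, h4, h5, h6, h7, -⟩ := ht.coprime_classification'
        (Int.isCoprime_iff_gcd_eq_one.1 hcz.symm) hz2 hx2
      obtain ⟨y', rfl⟩ := Int.dvd_of_emod_eq_zero hy2
      have hy' : y' ≠ 0 := right_ne_zero_of_mul hy
      have key : ∀ m k : ℤ, Int.gcd m k = 1 → m % 2 = 0 → k % 2 = 1 → (2 * y') ^ 2 = 2 * m * k →
          x ^ 2 = m ^ 2 + k ^ 2 → False := by
        intro m k h6 hm hk h4 h5
        obtain ⟨m', rfl⟩ := Int.dvd_of_emod_eq_zero hm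
        have h8 : m' * k = y' ^ 2 := by linarith
        have h9 : IsCoprime m' k := (Int.isCoprime_iff_gcd_eq_one.2 h6).of_mul_left_right
        obtain ⟨i, hi⟩ := Int.sq_of_gcd_eq_one (Int.isCoprime_iff_gcd_eq_one.1 h9) h8
        obtain ⟨j, hj⟩ := Int.sq_of_gcd_eq_one (Int.isCoprime_iff_gcd_eq_one.1 h9.symm)
          ((mul_comm _ _).trans h8)
        have hi2 : m' ^ 2 = i ^ 4 := by rcases hi with h | h <;> rw [h] <;> ring
        have hj2 : k ^ 2 = j ^ 4 := by rcases hj with h | h <;> rw [h] <;> ring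
        have hi0 : i ≠ 0 := by
          rintro rfl
          apply hy'
          have : m' = 0 := by simpa using hi
          simpa [this] using h8.symm
        have hj0 : j % 2 = 1 := by
          rcases Int.emod_two_eq_zero_or_one j with h0 | h0
          · exfalso
            have h1 : (2 : ℤ) ∣ k := by
              have := dvd_pow (Int.dvd_of_emod_eq_zero h0) two_ne_zero
              rcases hj with h | h <;> rw [h]
              · exact this
              · exact (dvd_neg).2 this
            omega
          · exact h0
        have hji : IsCoprime j i := by
          have h1 : IsCoprime (j ^ 2) (i ^ 2) := by
            rcases hi with h | h <;> rcases hj with h' | h' <;> rw [h, h'] at h9 <;>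
              simpa only [IsCoprime.neg_left_iff, IsCoprime.neg_right_iff] using h9.symm
          exact (IsCoprime.pow_iff (by norm_num) (by norm_num)).1 h1
        obtain ⟨A, B, hB, hAB, hA⟩ := exists_sq_eq_four_sub_four (x := x) hi0 hji hj0
          (by rw [h5, mul_pow, hi2, hj2]; ring)
        refine ih A.natAbs (hn ▸ hA) rfl hB ?_ hAB.symm
        rintro rfl
        simp at hj0
      rcases h7 with ⟨hm, hk⟩ | ⟨hm, hk⟩
      · exact key m k h6 hm hk h4 h5
      · exact key k m (by rwa [Int.gcd_comm]) hk hm (by linarith) (by linarith)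
    · have hy2' : y ^ 2 % 2 = 1 := by rw [sq, Int.mul_emod, hy2]; decide
      have ht : PythagoreanTriple (y ^ 2) z (x ^ 2) := by
        delta PythagoreanTriple
        linear_combination -h
      obtain ⟨m, k, h3, h4, h5, -⟩ := ht.coprime_classification'
        (Int.isCoprime_iff_gcd_eq_one.1 hcz) hy2' hx2
      have hk : k ≠ 0 := by
        rintro rfl
        exact hz (by simpa using h4)
      refine ih m.natAbs ?_ rfl hk (mul_ne_zero hx hy) (x := m) (y := k) (z := x * y) ?_
      · rw [← hn, Int.natAbs_lt_iff_sq_lt]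
        have : 0 < k ^ 2 := by positivity
        linarith
      · rw [mul_pow, h3, h5]
        ring

theorem Rat.exists_int_mul_eq (x y z : ℚ) :
    ∃ d X Y Z : ℤ, d ≠ 0 ∧ (X : ℚ) = x * d ∧ (Y : ℚ) = y * d ∧ (Z : ℚ) = z * d ^ 2 := by
  refine ⟨x.den * y.den * z.den, x.num * (y.den * z.den), y.num * (x.den * z.den),
    z.num * (x.den * y.den) * (x.den * y.den * z.den), by simp, ?_, ?_, ?_⟩ <;> push_cast
  · rw [← Rat.mul_den_eq_num x]; ring
  · rw [← Rat.mul_den_eq_num y]; ring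
  · rw [← Rat.mul_den_eq_num z]; ring

theorem Rat.four_sub_four_ne_sq {x y z : ℚ} (hy : y ≠ 0) (hz : z ≠ 0) : x ^ 4 - y ^ 4 ≠ z ^ 2 := by
  intro h
  obtain ⟨d, X, Y, Z, hd, hX, hY, hZ⟩ := Rat.exists_int_mul_eq x y z
  rw [← Int.cast_ne_zero (α := ℚ)] at hd
  refine Int.four_sub_four_ne_sq _ (x := X) (y := Y) (z := Z) rfl ?_ ?_ ?_
  · rw [← Int.cast_ne_zero (α := ℚ), hY]; positivity
  · rw [← Int.cast_ne_zero (α := ℚ), hZ]; positivity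
  · have : (X : ℚ) ^ 4 - (Y : ℚ) ^ 4 = (Z : ℚ) ^ 2 := by
      rw [hX, hY, hZ]
      linear_combination (d : ℚ) ^ 4 * h
    exact_mod_cast this

theorem Rat.four_add_four_ne_sq {x y z : ℚ} (hx : x ≠ 0) (hy : y ≠ 0) : x ^ 4 + y ^ 4 ≠ z ^ 2 := by
  intro h
  obtain ⟨d, X, Y, Z, hd, hX, hY, hZ⟩ := Rat.exists_int_mul_eq x y z
  rw [← Int.cast_ne_zero (α := ℚ)] at hd
  refine not_fermat_42 (a := X) (b := Y) (c := Z) ?_ ?_ ?_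
  · rw [← Int.cast_ne_zero (α := ℚ), hX]; positivity
  · rw [← Int.cast_ne_zero (α := ℚ), hY]; positivity
  · have : (X : ℚ) ^ 4 + (Y : ℚ) ^ 4 = (Z : ℚ) ^ 2 := by
      rw [hX, hY, hZ]
      linear_combination (d : ℚ) ^ 4 * h
    exact_mod_cast this

/-- A solution would give `z ^ 4 + (2 * x * y) ^ 4 = (x ^ 4 + 4 * y ^ 4) ^ 2`. -/
theorem Rat.four_sub_four_mul_four_ne_sq {x y z : ℚ} (hy : y ≠ 0) (hz : z ≠ 0) :
    x ^ 4 - 4 * y ^ 4 ≠ z ^ 2 := by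
  intro h
  have hx : x ≠ 0 := by
    rintro rfl
    have : 0 < y ^ 4 := by positivity
    nlinarith [sq_nonneg z]
  refine Rat.four_add_four_ne_sq hz (mul_ne_zero (mul_ne_zero two_ne_zero hx) hy)
    (z := x ^ 4 + 4 * y ^ 4) ?_
  have : z ^ 4 = (x ^ 4 - 4 * y ^ 4) ^ 2 := by rw [h]; ring
  rw [this]
  ring

/-- No fourth power times a power of four differs from a fourth power by plus or minus a square,
except trivially. -/
theorem Rat.four_zpow_mul_four_sub_four_ne {a b z : ℚ} (ha : a ≠ 0) (hb : b ≠ 0) (hz : z ≠ 0)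
    (k : ℤ) : 4 ^ k * a ^ 4 - b ^ 4 ≠ z ^ 2 ∧ b ^ 4 - 4 ^ k * a ^ 4 ≠ z ^ 2 := by
  have h4 (j : ℤ) : (4 : ℚ) ^ (2 * j) = (2 ^ j) ^ 4 := by
    rw [show (4 : ℚ) = 2 ^ (2 : ℤ) by norm_num, ← zpow_mul, ← zpow_natCast, ← zpow_mul]
    congr 1
    push_cast
    ring
  rcases Int.even_or_odd' k with ⟨j, rfl | rfl⟩
  · rw [h4, ← mul_pow]
    have h2 : (2 : ℚ) ^ j * a ≠ 0 := by positivity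
    exact ⟨Rat.four_sub_four_ne_sq hb hz, Rat.four_sub_four_ne_sq h2 hz⟩
  · rw [zpow_add_one₀ (by norm_num), h4, mul_right_comm, ← mul_pow]
    have h2 : (2 : ℚ) ^ j * a ≠ 0 := by positivity
    constructor
    · intro h
      -- Multiplication by 4 moves the factor 4 from the first fourth power to the second.
      refine Rat.four_sub_four_mul_four_ne_sq (x := 2 * (2 ^ j * a)) hb
        (mul_ne_zero two_ne_zero hz) ?_
      linear_combination 4 * h
    · intro h
      refine Rat.four_sub_four_mul_four_ne_sq (x := b) h2 hz ?_
      linear_combination h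

/-! ### The group law of `y ^ 2 = x ^ 3 + a * x ^ 2 + b * x` and the local parameter at infinity. -/

open WeierstrassCurve.Affine

/-- The curve `y ^ 2 = x ^ 3 + a * x ^ 2 + b * x`. -/
abbrev twoTorsionCurve (a b : ℚ) : WeierstrassCurve.Affine ℚ where
  a₁ := 0
  a₂ := a
  a₃ := 0
  a₄ := b
  a₆ := 0

namespace twoTorsionCurve

variable {a b : ℚ}

theorem equation_iff {x y : ℚ} :
    (twoTorsionCurve a b).Equation x y ↔ y ^ 2 = x ^ 3 + a * x ^ 2 + b * x := by
  rw [WeierstrassCurve.Affine.equation_iff]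
  simp

theorem negY_eq (x y : ℚ) : (twoTorsionCurve a b).negY x y = -y := by
  simp [negY]

theorem neg_some {x y : ℚ} (h : (twoTorsionCurve a b).Nonsingular x y) :
    ∃ h', -Point.some x y h = Point.some x (-y) h' := by
  have h' := (nonsingular_neg x y).2 h
  rw [negY_eq] at h'
  refine ⟨h', ?_⟩
  rw [Point.neg_some, Point.some.injEq]
  exact ⟨rfl, negY_eq x y⟩

theorem add_self_eq_zero {x : ℚ} (h : (twoTorsionCurve a b).Nonsingular x 0) :
    Point.some x 0 h + Point.some x 0 h = 0 :=
  Point.add_self_of_Y_eq (by simp [negY])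

theorem add_self {x y : ℚ} (h : (twoTorsionCurve a b).Nonsingular x y) (hy : y ≠ 0) :
    ∃ y' h', Point.some x y h + Point.some x y h
      = Point.some ((x ^ 2 - b) ^ 2 / (4 * y ^ 2)) y' h' := by
  have hy' : y ≠ (twoTorsionCurve a b).negY x y := by
    rw [negY_eq]
    intro h0
    exact hy (by linarith)
  have key : (twoTorsionCurve a b).addX x x ((twoTorsionCurve a b).slope x x y y)
      = (x ^ 2 - b) ^ 2 / (4 * y ^ 2) := by
    rw [slope_of_Y_ne rfl hy', negY_eq, addX]
    have h1 := equation_iff.1 h.1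
    simp only [zero_mul, sub_zero, add_zero, sub_neg_eq_add, ← two_mul]
    field_simp
    linear_combination (-16 * (2 * x + a)) * h1
  rw [Point.add_self_of_Y_ne hy', ← key]
  exact ⟨_, _, rfl⟩

theorem add_of_ne {x₁ y₁ x₂ y₂ : ℚ} (h₁ : (twoTorsionCurve a b).Nonsingular x₁ y₁)
    (h₂ : (twoTorsionCurve a b).Nonsingular x₂ y₂) (hx : x₁ ≠ x₂) :
    ∃ y h, Point.some x₁ y₁ h₁ + Point.some x₂ y₂ h₂
      = Point.some (((y₁ - y₂) / (x₁ - x₂)) ^ 2 - a - x₁ - x₂) y h := by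
  have key : (twoTorsionCurve a b).addX x₁ x₂ ((twoTorsionCurve a b).slope x₁ x₂ y₁ y₂)
      = ((y₁ - y₂) / (x₁ - x₂)) ^ 2 - a - x₁ - x₂ := by
    rw [slope_of_X_ne hx, addX]
    simp
  rw [Point.add_of_X_ne hx, ← key]
  exact ⟨_, _, rfl⟩

/-- The local parameter `g ^ 2 / x` at the point at infinity takes the value `z`. -/
def HasParam (g : ℚ) (P : (twoTorsionCurve a b).Point) (z : ℚ) : Prop :=
  P.xRep 0 ≠ 0 ∧ z = g ^ 2 * P.xRep 1 / P.xRep 0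

theorem hasParam_zero (g : ℚ) : HasParam g (0 : (twoTorsionCurve a b).Point) 0 := by
  simp [HasParam]

theorem hasParam_zero_iff {g z : ℚ} :
    HasParam g (0 : (twoTorsionCurve a b).Point) z ↔ z = 0 := by
  simp [HasParam]

theorem hasParam_some {g x y z : ℚ} {h : (twoTorsionCurve a b).Nonsingular x y} :
    HasParam g (Point.some x y h) z ↔ x ≠ 0 ∧ z = g ^ 2 / x := by
  simp [HasParam]

theorem HasParam.neg {g z : ℚ} {P : (twoTorsionCurve a b).Point} (h : HasParam g P z) :
    HasParam g (-P) z := by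
  simpa [HasParam] using h

/-- The abscissae `x₃`, `x₄` of `P + Q` and `P - Q` have sum and product rational in `x₁`, `x₂`,
both with denominator `(x₁ - x₂) ^ 2`. It cancels in `1 / x₃ + 1 / x₄`, which leaves a formula that
still makes sense for `x₁ = x₂`. -/
theorem param_add_sub_aux {g x₁ y₁ x₂ y₂ : ℚ} (hg : g ≠ 0) (hx₁ : x₁ ≠ 0) (hx₂ : x₂ ≠ 0)
    (e₁ : y₁ ^ 2 = x₁ ^ 3 + g ^ 2 * a * x₁ ^ 2 + g ^ 4 * b * x₁)
    (e₂ : y₂ ^ 2 = x₂ ^ 3 + g ^ 2 * a * x₂ ^ 2 + g ^ 4 * b * x₂) (hx : x₁ ≠ x₂)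
    (hz : 1 - b * (g ^ 2 / x₁) * (g ^ 2 / x₂) ≠ 0) :
    ((y₁ - y₂) / (x₁ - x₂)) ^ 2 - g ^ 2 * a - x₁ - x₂ ≠ 0 ∧
    ((y₁ - -y₂) / (x₁ - x₂)) ^ 2 - g ^ 2 * a - x₁ - x₂ ≠ 0 ∧
    g ^ 2 / (((y₁ - y₂) / (x₁ - x₂)) ^ 2 - g ^ 2 * a - x₁ - x₂)
      + g ^ 2 / (((y₁ - -y₂) / (x₁ - x₂)) ^ 2 - g ^ 2 * a - x₁ - x₂)
      = (2 * (g ^ 2 / x₁ + g ^ 2 / x₂) * (1 + b * (g ^ 2 / x₁) * (g ^ 2 / x₂))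
        + 4 * a * (g ^ 2 / x₁) * (g ^ 2 / x₂)) / (1 - b * (g ^ 2 / x₁) * (g ^ 2 / x₂)) ^ 2 := by
  have hd : x₁ - x₂ ≠ 0 := sub_ne_zero.2 hx
  have hz' : x₁ * x₂ - g ^ 4 * b ≠ 0 := by
    intro h0
    apply hz
    field_simp
    linear_combination h0
  have h5 : (((y₁ - y₂) / (x₁ - x₂)) ^ 2 - g ^ 2 * a - x₁ - x₂) * (x₁ - x₂) ^ 2
      = x₁ * x₂ * (x₁ + x₂) + 2 * (g ^ 2 * a) * x₁ * x₂ + g ^ 4 * b * (x₁ + x₂)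
        - 2 * y₁ * y₂ := by
    field_simp
    linear_combination e₁ + e₂
  have h6 : (((y₁ - -y₂) / (x₁ - x₂)) ^ 2 - g ^ 2 * a - x₁ - x₂) * (x₁ - x₂) ^ 2
      = x₁ * x₂ * (x₁ + x₂) + 2 * (g ^ 2 * a) * x₁ * x₂ + g ^ 4 * b * (x₁ + x₂)
        + 2 * y₁ * y₂ := by
    field_simp
    linear_combination e₁ + e₂
  generalize ((y₁ - y₂) / (x₁ - x₂)) ^ 2 - g ^ 2 * a - x₁ - x₂ = x₃ at *
  generalize ((y₁ - -y₂) / (x₁ - x₂)) ^ 2 - g ^ 2 * a - x₁ - x₂ = x₄ at *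
  have hs : (x₃ + x₄) * (x₁ - x₂) ^ 2
      = 2 * (x₁ + x₂) * (g ^ 4 * b + x₁ * x₂) + 4 * (g ^ 2 * a) * x₁ * x₂ := by
    linear_combination h5 + h6
  have hp : x₃ * x₄ * (x₁ - x₂) ^ 2 = (x₁ * x₂ - g ^ 4 * b) ^ 2 := by
    have h7 : (x₃ * (x₁ - x₂) ^ 2) * (x₄ * (x₁ - x₂) ^ 2)
        = (x₁ * x₂ - g ^ 4 * b) ^ 2 * (x₁ - x₂) ^ 2 := by
      rw [h5, h6]
      linear_combination -4 * y₂ ^ 2 * e₁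
        - 4 * (x₁ ^ 3 + g ^ 2 * a * x₁ ^ 2 + g ^ 4 * b * x₁) * e₂
    exact mul_right_cancel₀ (pow_ne_zero 2 hd) (by linear_combination h7)
  have h34 : x₃ * x₄ ≠ 0 := by
    intro h0
    rw [h0, zero_mul] at hp
    exact pow_ne_zero 2 hz' hp.symm
  have hx3 : x₃ ≠ 0 := left_ne_zero_of_mul h34
  have hx4 : x₄ ≠ 0 := right_ne_zero_of_mul h34
  refine ⟨hx3, hx4, ?_⟩
  have h8 : g ^ 2 / x₃ + g ^ 2 / x₄
      = g ^ 2 * ((x₃ + x₄) * (x₁ - x₂) ^ 2) / (x₃ * x₄ * (x₁ - x₂) ^ 2) := by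
    field_simp
    ring
  have h9 : 1 - b * (g ^ 2 / x₁) * (g ^ 2 / x₂) = (x₁ * x₂ - g ^ 4 * b) / (x₁ * x₂) := by
    field_simp
  rw [h8, hs, hp, h9]
  clear h5 h6 h8 h9 hs hp hz e₁ e₂
  field_simp
  ring

/-- The sum of the local parameters of `P + Q` and `P - Q` in terms of those of `P` and `Q`. -/
theorem HasParam.add_sub {g z₁ z₂ : ℚ} (hg : g ≠ 0)
    {P Q : (twoTorsionCurve (g ^ 2 * a) (g ^ 4 * b)).Point}
    (hP : HasParam g P z₁) (hQ : HasParam g Q z₂) (hz : 1 - b * z₁ * z₂ ≠ 0) :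
    ∃ z₃ z₄, HasParam g (P + Q) z₃ ∧ HasParam g (P - Q) z₄ ∧
      z₃ + z₄ = (2 * (z₁ + z₂) * (1 + b * z₁ * z₂) + 4 * a * z₁ * z₂) / (1 - b * z₁ * z₂) ^ 2 := by
  -- When `P = ±Q`, one of `P + Q`, `P - Q` is the origin, with parameter `0`, and the formula
  -- reduces to duplication.
  have dbl : ∀ {z : ℚ} {P : (twoTorsionCurve (g ^ 2 * a) (g ^ 4 * b)).Point}, HasParam g P z →
      1 - b * z * z ≠ 0 → HasParam g (P + P) ((2 * (z + z) * (1 + b * z * z) + 4 * a * z * z) /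
        (1 - b * z * z) ^ 2) := by
    intro z P hP hz
    rcases P with _ | ⟨x, y, h⟩
    · rw [← Point.zero_def] at hP ⊢
      obtain rfl := hasParam_zero_iff.1 hP
      simpa using hP
    · obtain ⟨hx, rfl⟩ := hasParam_some.1 hP
      have h1 := equation_iff.1 h.1
      have h2 : x ^ 2 - g ^ 4 * b ≠ 0 := by
        intro h0
        apply hz
        field_simp
        linear_combination h0
      rcases eq_or_ne y 0 with rfl | hy
      · rw [add_self_eq_zero]
        have h3 : x ^ 2 + g ^ 2 * a * x + g ^ 4 * b = 0 := by
          have : x * (x ^ 2 + g ^ 2 * a * x + g ^ 4 * b) = 0 := by linear_combination -h1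
          exact (mul_eq_zero.1 this).resolve_left hx
        have h4 : 2 * (g ^ 2 / x + g ^ 2 / x) * (1 + b * (g ^ 2 / x) * (g ^ 2 / x))
            + 4 * a * (g ^ 2 / x) * (g ^ 2 / x) = 0 := by
          field_simp
          linear_combination 4 * g ^ 2 * h3
        rw [h4, zero_div]
        exact hasParam_zero g
      · obtain ⟨y', h', h3⟩ := add_self h hy
        rw [h3, hasParam_some]
        refine ⟨by positivity, ?_⟩
        have h4 : 1 - b * (g ^ 2 / x) * (g ^ 2 / x) = (x ^ 2 - g ^ 4 * b) / x ^ 2 := by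
          field_simp
        rw [h4]
        field_simp
        rw [h1]
        ring
  rcases P with _ | ⟨x₁, y₁, h₁⟩
  · rw [← Point.zero_def] at hP ⊢
    obtain rfl := hasParam_zero_iff.1 hP
    exact ⟨z₂, z₂, by rwa [zero_add], by rw [zero_sub]; exact hQ.neg, by ring⟩
  rcases Q with _ | ⟨x₂, y₂, h₂⟩
  · rw [← Point.zero_def] at hQ ⊢
    obtain rfl := hasParam_zero_iff.1 hQ
    exact ⟨z₁, z₁, by rwa [add_zero], by rwa [sub_zero], by ring⟩
  by_cases hx : x₁ = x₂
  · have hz12 : z₁ = z₂ := by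
      rw [(hasParam_some.1 hP).2, (hasParam_some.1 hQ).2, hx]
    subst hz12
    rcases Point.X_eq_iff.1 hx with h | h
    · rw [← h]
      exact ⟨_, 0, dbl hP hz, by rw [sub_self]; exact hasParam_zero g, by ring⟩
    · rw [eq_neg_iff_add_eq_zero] at h
      refine ⟨0, _, by rw [h]; exact hasParam_zero g, ?_, zero_add _⟩
      rw [sub_eq_add_neg, ← eq_neg_of_add_eq_zero_left h]
      exact dbl hP hz
  · obtain ⟨hx₁, rfl⟩ := hasParam_some.1 hP
    obtain ⟨hx₂, rfl⟩ := hasParam_some.1 hQ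
    obtain ⟨h₂', hneg⟩ := neg_some h₂
    obtain ⟨y₃, h₃, hadd⟩ := add_of_ne h₁ h₂ hx
    obtain ⟨y₄, h₄, hsub⟩ := add_of_ne h₁ h₂' hx
    obtain ⟨hx₃, hx₄, hs⟩ := param_add_sub_aux hg hx₁ hx₂ (equation_iff.1 h₁.1)
      (equation_iff.1 h₂.1) hx hz
    refine ⟨_, _, ?_, ?_, hs⟩
    · rw [hadd, hasParam_some]
      exact ⟨hx₃, rfl⟩
    · rw [sub_eq_add_neg, hneg, hsub, hasParam_some]
      exact ⟨hx₄, rfl⟩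

end twoTorsionCurve

/-! ### Estimates for the p-adic norm. -/

section PadicNorm

variable {p : ℕ} [hp : Fact p.Prime]

theorem padicNorm.pow (x : ℚ) (n : ℕ) : padicNorm p (x ^ n) = padicNorm p x ^ n :=
  IsAbsoluteValue.abv_pow (padicNorm p) x n

theorem padicNorm.add_le_of_le {x y c : ℚ} (hx : padicNorm p x ≤ c) (hy : padicNorm p y ≤ c) :
    padicNorm p (x + y) ≤ c :=
  padicNorm.nonarchimedean.trans (max_le hx hy)

theorem padicNorm.sub_le_of_le {x y c : ℚ} (hx : padicNorm p x ≤ c) (hy : padicNorm p y ≤ c) :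
    padicNorm p (x - y) ≤ c :=
  padicNorm.sub.trans (max_le hx hy)

theorem padicNorm.mul_le_of_le {x y c d : ℚ} (hx : padicNorm p x ≤ c) (hy : padicNorm p y ≤ d) :
    padicNorm p (x * y) ≤ c * d := by
  rw [padicNorm.mul]
  exact mul_le_mul hx hy (padicNorm.nonneg _) ((padicNorm.nonneg _).trans hx)

theorem padicNorm.sub_eq_left_of_lt {x y : ℚ} (h : padicNorm p y < padicNorm p x) :
    padicNorm p (x - y) = padicNorm p x := by
  rw [sub_eq_add_neg, padicNorm.add_eq_max_of_ne, padicNorm.neg, max_eq_left h.le]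
  rw [padicNorm.neg]
  exact h.ne'

theorem padicNorm.add_eq_left_of_lt {x y : ℚ} (h : padicNorm p y < padicNorm p x) :
    padicNorm p (x + y) = padicNorm p x := by
  rw [padicNorm.add_eq_max_of_ne h.ne', max_eq_left h.le]

theorem padicNorm.le_inv_of_lt_one {x : ℚ} (h : padicNorm p x < 1) :
    padicNorm p x ≤ (p : ℚ)⁻¹ := by
  have hp1 : (1 : ℚ) < p := by exact_mod_cast hp.out.one_lt
  rcases eq_or_ne x 0 with rfl | hx
  · rw [padicNorm.zero]
    positivity
  · obtain ⟨k, hk⟩ := padicNorm.values_discrete (p := p) hx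
    rw [hk, ← zpow_neg_one]
    rw [hk] at h
    have : -k < 0 := (zpow_lt_one_iff_right₀ hp1).1 h
    exact zpow_le_zpow_right₀ hp1.le (by lia)

end PadicNorm

/-! ### Points near infinity, and integrality of torsion abscissae. -/

namespace twoTorsionCurve

variable {a b : ℚ} {p : ℕ} [hp : Fact p.Prime]

theorem HasParam.unique {g z w : ℚ} {P : (twoTorsionCurve a b).Point} (h : HasParam g P z)
    (h' : HasParam g P w) : z = w :=
  h.2.trans h'.2.symm

theorem cast_choose_succ_three (n : ℕ) :
    ((n + 1).choose 3 : ℚ) = (n + 1) * n * (n - 1) / 6 := by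
  induction n with
  | zero => norm_num [Nat.choose]
  | succ n ih =>
    rw [Nat.choose_succ_succ' (n + 1) 2, Nat.cast_add, ih, Nat.cast_choose_two]
    push_cast
    ring

/-- The expansion to second order of the local parameter of the multiples of a point near the
point at infinity. -/
theorem HasParam.nsmul {g z : ℚ} (hg : g ≠ 0)
    {P : (twoTorsionCurve (g ^ 2 * a) (g ^ 4 * b)).Point} (hP : HasParam g P z)
    (ha : padicNorm p a ≤ 1) (hb : padicNorm p b ≤ 1) (hz : padicNorm p z < 1) (n : ℕ) :
    ∃ w, HasParam g (n • P) w ∧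
      padicNorm p (w - (n ^ 2 * z + (2 * n * (n + 1).choose 3 : ℕ) * a * z ^ 2))
        ≤ padicNorm p z ^ 3 := by
  set Z := padicNorm p z with hZ
  have hZ0 : 0 ≤ Z := padicNorm.nonneg z
  induction n using Nat.twoStepInduction with
  | zero =>
    refine ⟨0, by rw [zero_nsmul]; exact hasParam_zero g, ?_⟩
    simp only [Nat.cast_zero, mul_zero, zero_mul, ne_eq, OfNat.ofNat_ne_zero, not_false_eq_true,
      zero_pow, add_zero, sub_zero, padicNorm.zero]
    positivity
  | one =>
    refine ⟨z, by rwa [one_nsmul], ?_⟩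
    have h1 : Nat.choose (1 + 1) 3 = 0 := rfl
    rw [h1]
    simp only [Nat.cast_one, one_pow, one_mul, mul_zero, Nat.cast_zero, zero_mul, add_zero,
      sub_self, padicNorm.zero]
    positivity
  | more n ih₀ ih₁ =>
    obtain ⟨w₀, hw₀, e₀⟩ := ih₀
    obtain ⟨w, hw, e₁⟩ := ih₁
    set m : ℕ := n + 1 with hm
    have hnat (k : ℕ) : padicNorm p (k : ℚ) ≤ 1 := padicNorm.of_nat k
    set c : ℕ := 2 * m * (m + 1).choose 3 with hc
    have h2 : padicNorm p (w - m ^ 2 * z) ≤ Z ^ 2 := by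
      have : w - m ^ 2 * z = (w - (m ^ 2 * z + c * a * z ^ 2)) + c * a * z ^ 2 := by ring
      rw [this]
      refine padicNorm.add_le_of_le (e₁.trans ?_) ?_
      · exact pow_le_pow_of_le_one hZ0 hz.le (by norm_num)
      · refine (padicNorm.mul_le_of_le (padicNorm.mul_le_of_le (hnat c) ha)
          (padicNorm.pow z 2).le).trans_eq ?_
        ring
    have h3 : padicNorm p w ≤ Z := by
      have : w = (w - m ^ 2 * z) + (m ^ 2 : ℕ) * z := by push_cast; ring
      rw [this]
      refine padicNorm.add_le_of_le (h2.trans ?_) ?_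
      · exact (pow_le_of_le_one hZ0 hz.le (by norm_num))
      · exact (padicNorm.mul_le_of_le (hnat _) le_rfl).trans_eq (one_mul _)
    have hq : padicNorm p (b * w * z) ≤ Z ^ 2 :=
      (padicNorm.mul_le_of_le (padicNorm.mul_le_of_le hb h3) le_rfl).trans_eq (by ring)
    have hq1 : padicNorm p (b * w * z) < 1 := hq.trans_lt (pow_lt_one₀ hZ0 hz two_ne_zero)
    have hD : padicNorm p (1 - b * w * z) = 1 := by
      rw [padicNorm.sub_eq_left_of_lt (by rwa [padicNorm.one]), padicNorm.one]
    have hD0 : 1 - b * w * z ≠ 0 := by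
      intro h0
      rw [h0, padicNorm.zero] at hD
      exact zero_ne_one hD
    obtain ⟨w', w₀', hw', hw₀', hsum⟩ := HasParam.add_sub hg hw hP hD0
    have h4 : w₀' = w₀ := by
      refine hw₀'.unique ?_
      rwa [hm, succ_nsmul, add_sub_cancel_right]
    subst h4
    refine ⟨w', by rw [show n + 2 = m + 1 from rfl, succ_nsmul]; exact hw', ?_⟩
    -- Every term of the new error has third order: `b * w * z` has second order and its cofactor
    -- first order, and the other terms carry the errors already bounded.
    have hE : w' - ((n + 2 : ℕ) ^ 2 * z
        + (2 * (n + 2) * (n + 2 + 1).choose 3 : ℕ) * a * z ^ 2)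
        = b * w * z * (((2 : ℕ) * (w + z) * ((3 : ℕ) - b * w * z)
          + (4 : ℕ) * a * w * z * ((2 : ℕ) - b * w * z)) / (1 - b * w * z) ^ 2)
        + (2 : ℕ) * (w - (m ^ 2 * z + c * a * z ^ 2)) + (4 : ℕ) * a * z * (w - m ^ 2 * z)
        - (w₀' - (n ^ 2 * z + (2 * n * (n + 1).choose 3 : ℕ) * a * z ^ 2)) := by
      have h5 : w' = (2 * (w + z) * (1 + b * w * z) + 4 * a * w * z) / (1 - b * w * z) ^ 2
        - w₀' := by linear_combination hsum
      rw [h5, hc, hm]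
      simp only [Nat.cast_mul, cast_choose_succ_three]
      push_cast
      generalize b * w * z = q at *
      field_simp
      ring
    rw [hE]
    refine padicNorm.sub_le_of_le (padicNorm.add_le_of_le (padicNorm.add_le_of_le ?_ ?_) ?_) e₀
    · have h6 : padicNorm p (((2 : ℕ) * (w + z) * ((3 : ℕ) - b * w * z)
          + (4 : ℕ) * a * w * z * ((2 : ℕ) - b * w * z)) / (1 - b * w * z) ^ 2) ≤ Z := by
        rw [padicNorm.div, padicNorm.pow, hD, one_pow, div_one]
        refine padicNorm.add_le_of_le ?_ ?_
        · refine (padicNorm.mul_le_of_le (padicNorm.mul_le_of_le (hnat 2)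
            (padicNorm.add_le_of_le h3 le_rfl))
            (padicNorm.sub_le_of_le (hnat 3) hq1.le)).trans_eq (by ring)
        · refine (padicNorm.mul_le_of_le (padicNorm.mul_le_of_le (padicNorm.mul_le_of_le
            (padicNorm.mul_le_of_le (hnat 4) ha) (h3.trans hz.le)) le_rfl)
            (padicNorm.sub_le_of_le (hnat 2) hq1.le)).trans_eq (by ring)
      exact (padicNorm.mul_le_of_le hq h6).trans_eq (by ring)
    · exact (padicNorm.mul_le_of_le (hnat 2) e₁).trans_eq (one_mul _)
    · exact (padicNorm.mul_le_of_le (padicNorm.mul_le_of_le (padicNorm.mul_le_of_le (hnat 4) ha)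
        le_rfl) h2).trans_eq (by ring)

/-- The curve equation reads `(y * z ^ 2 / g ^ 3) ^ 2 = z * (1 + a * z + b * z ^ 2)`, whose last
factor is a unit. So `z` has even valuation, and positive valuation means at least two. -/
theorem HasParam.padicNorm_le {g z : ℚ} (hg : g ≠ 0)
    {P : (twoTorsionCurve (g ^ 2 * a) (g ^ 4 * b)).Point} (hP : HasParam g P z) (hP0 : P ≠ 0)
    (ha : padicNorm p a ≤ 1) (hb : padicNorm p b ≤ 1) (hz : padicNorm p z < 1) :
    0 < padicNorm p z ∧ padicNorm p z ≤ (p : ℚ)⁻¹ ^ 2 := by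
  rcases P with _ | ⟨x, y, h⟩
  · exact absurd rfl hP0
  obtain ⟨hx, rfl⟩ := hasParam_some.1 hP
  have h1 := equation_iff.1 h.1
  set z := g ^ 2 / x with hzd
  have hz0 : z ≠ 0 := by positivity
  refine ⟨lt_of_le_of_ne (padicNorm.nonneg z) (padicNorm.nonzero hz0).symm, ?_⟩
  have h2 : (y * z ^ 2 / g ^ 3) ^ 2 = z * (1 + (a * z + b * z * z)) := by
    rw [div_pow, mul_pow, h1, hzd]
    field_simp
    ring
  have hu : padicNorm p (a * z + b * z * z) < 1 := by
    refine lt_of_le_of_lt (padicNorm.add_le_of_le (c := padicNorm p z) ?_ ?_) hz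
    · exact (padicNorm.mul_le_of_le ha le_rfl).trans_eq (one_mul _)
    · exact (padicNorm.mul_le_of_le (padicNorm.mul_le_of_le hb hz.le) le_rfl).trans_eq (by ring)
  have h3 : padicNorm p (y * z ^ 2 / g ^ 3) ^ 2 = padicNorm p z := by
    rw [← padicNorm.pow, h2, padicNorm.mul,
      padicNorm.add_eq_left_of_lt (by rwa [padicNorm.one]), padicNorm.one, mul_one]
  rw [← h3] at hz ⊢
  have h4 : padicNorm p (y * z ^ 2 / g ^ 3) < 1 :=
    (pow_lt_one_iff_of_nonneg (padicNorm.nonneg _) two_ne_zero).1 hz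
  exact pow_le_pow_left₀ (padicNorm.nonneg _) (padicNorm.le_inv_of_lt_one h4) 2

/-- Points close to the point at infinity have infinite order. -/
theorem HasParam.not_isOfFinAddOrder {g z : ℚ} (hg : g ≠ 0)
    {P : (twoTorsionCurve (g ^ 2 * a) (g ^ 4 * b)).Point} (hP : HasParam g P z) (hP0 : P ≠ 0)
    (ha : padicNorm p a ≤ 1) (hb : padicNorm p b ≤ 1) (hz : padicNorm p z < 1) :
    ¬ IsOfFinAddOrder P := by
  intro hfin
  have hp1 : (1 : ℚ) < p := by exact_mod_cast hp.out.one_lt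
  have hpi : (p : ℚ)⁻¹ < 1 := inv_lt_one_of_one_lt₀ hp1
  have hpi0 : 0 < (p : ℚ)⁻¹ := by positivity
  have hN1 : addOrderOf P ≠ 1 := by
    rwa [Ne, AddMonoid.addOrderOf_eq_one_iff]
  -- It suffices to refute a nonzero multiple `R = k • P` of prime order `q`; its parameter is again
  -- small.
  obtain ⟨q, hq, k, hk⟩ := Nat.exists_prime_and_dvd hN1
  have hN0 : 0 < addOrderOf P := hfin.addOrderOf_pos
  have hR0 : k • P ≠ 0 := by
    intro h0
    have h1 := addOrderOf_dvd_of_nsmul_eq_zero h0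
    rw [hk] at h1 hN0
    have h2 : 0 < k := Nat.pos_of_mul_pos_left hN0
    have := Nat.le_of_dvd h2 h1
    nlinarith [hq.two_le]
  have hqR : q • k • P = 0 := by
    rw [smul_smul, ← hk, addOrderOf_nsmul_eq_zero]
  have hnat (n : ℕ) : padicNorm p (n : ℚ) ≤ 1 := padicNorm.of_nat n
  obtain ⟨w, hw, hwz⟩ := HasParam.nsmul hg hP ha hb hz k
  have hZ0 : 0 ≤ padicNorm p z := padicNorm.nonneg z
  have hw1 : padicNorm p w < 1 := by
    have h1 : w = (w - (k ^ 2 * z + (2 * k * (k + 1).choose 3 : ℕ) * a * z ^ 2))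
        + ((k ^ 2 : ℕ) * z + (2 * k * (k + 1).choose 3 : ℕ) * a * z * z) := by push_cast; ring
    rw [h1]
    refine (padicNorm.add_le_of_le (c := padicNorm p z) (hwz.trans
      (pow_le_of_le_one hZ0 hz.le (by norm_num))) (padicNorm.add_le_of_le ?_ ?_)).trans_lt hz
    · exact (padicNorm.mul_le_of_le (hnat _) le_rfl).trans_eq (one_mul _)
    · exact (padicNorm.mul_le_of_le (padicNorm.mul_le_of_le (padicNorm.mul_le_of_le (hnat _) ha)
        hz.le) le_rfl).trans_eq (by ring)
  obtain ⟨hw0, hw2⟩ := HasParam.padicNorm_le hg hw hR0 ha hb hw1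
  obtain ⟨v, hv, hvw⟩ := HasParam.nsmul hg hw ha hb hw1 q
  rw [hqR, hasParam_zero_iff] at hv
  subst hv
  set W := padicNorm p w with hW
  have h5 : padicNorm p (q ^ 2 * w)
      ≤ max (W ^ 3) (padicNorm p (q : ℚ) * W ^ 2) := by
    -- The quadratic coefficient `q ^ 2 * (q ^ 2 - 1) / 3` equals `q` times an integer, for `q = 3`
    -- as well. The factor `q` is what makes the case `q = p` work.
    have h6 : (q ^ 2 * w : ℚ) = -(0 - (q ^ 2 * w + (2 * q * (q + 1).choose 3 : ℕ) * a * w ^ 2))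
        - q * ((2 * (q + 1).choose 3 : ℕ) * a * w ^ 2) := by push_cast; ring
    rw [h6]
    refine padicNorm.sub_le_of_le ?_ ?_
    · rw [padicNorm.neg]
      exact hvw.trans (le_max_left _ _)
    · refine le_trans ?_ (le_max_right _ _)
      refine padicNorm.mul_le_of_le le_rfl ?_
      exact (padicNorm.mul_le_of_le (padicNorm.mul_le_of_le (hnat _) ha)
        (padicNorm.pow w 2).le).trans_eq (by ring)
  have h7 : padicNorm p (q ^ 2 * w) = padicNorm p (q : ℚ) ^ 2 * W := by
    rw [padicNorm.mul, padicNorm.pow]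
  rw [h7] at h5
  -- For `q = p` the bound forces `W ≥ 1 / p`, against `W ≤ 1 / p ^ 2`; this covers `p = 2`. For `q
  -- ≠ p` the linear term dominates outright.
  by_cases hqp : q = p
  · subst hqp
    rw [padicNorm.padicNorm_p_of_prime] at h5
    set i := (q : ℚ)⁻¹
    rcases le_max_iff.1 h5 with h | h
    · have h8 : i ^ 2 ≤ W ^ 2 := le_of_mul_le_mul_right (by linarith) hw0
      have h9 : W ^ 2 ≤ (i ^ 2) ^ 2 := pow_le_pow_left₀ hw0.le hw2 2
      have h10 : i ^ 2 < 1 := pow_lt_one₀ hpi0.le hpi two_ne_zero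
      nlinarith [pow_pos hpi0 2]
    · have h8 : i ≤ W := le_of_mul_le_mul_left (a := i * W) (by linarith) (by positivity)
      nlinarith
  · have hq1 : padicNorm p (q : ℚ) = 1 := by
      rw [padicNorm.nat_eq_one_iff]
      intro h
      exact hqp ((Nat.prime_dvd_prime_iff_eq hp.out hq).1 h).symm
    rw [hq1] at h5
    have h8 : W ^ 2 < W := by nlinarith
    have h9 : W ^ 3 < W := by nlinarith
    rcases le_max_iff.1 h5 with h | h <;> linarith

/-- The abscissa of a point of finite order is integral at each prime, after any change of scale
that makes the coefficients of the curve integral. -/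
theorem padicNorm_le_of_isOfFinAddOrder {g x y : ℚ} (hg : g ≠ 0)
    (ha : padicNorm p a ≤ padicNorm p g ^ 2) (hb : padicNorm p b ≤ padicNorm p g ^ 4)
    {h : (twoTorsionCurve a b).Nonsingular x y} (hfin : IsOfFinAddOrder (Point.some x y h)) :
    padicNorm p x ≤ padicNorm p g ^ 2 := by
  obtain ⟨a, rfl⟩ : ∃ a', a = g ^ 2 * a' := ⟨a / g ^ 2, by field_simp⟩
  obtain ⟨b, rfl⟩ : ∃ b', b = g ^ 4 * b' := ⟨b / g ^ 4, by field_simp⟩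
  have hg0 : 0 < padicNorm p g := lt_of_le_of_ne (padicNorm.nonneg g) (padicNorm.nonzero hg).symm
  rw [padicNorm.mul, padicNorm.pow] at ha hb
  by_contra! hlt
  have hx : 0 < padicNorm p x := lt_of_le_of_lt (by positivity) hlt
  have hx0 : x ≠ 0 := by
    rintro rfl
    rw [padicNorm.zero] at hx
    exact lt_irrefl _ hx
  refine HasParam.not_isOfFinAddOrder (p := p) (z := g ^ 2 / x) hg (hasParam_some.2 ⟨hx0, rfl⟩)
    (Point.some_ne_zero h) ?_ ?_ ?_ hfin
  · exact le_of_mul_le_mul_left (by linarith) (pow_pos hg0 2)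
  · exact le_of_mul_le_mul_left (by linarith) (pow_pos hg0 4)
  · rw [padicNorm.div, padicNorm.pow]
    exact (div_lt_one hx).2 hlt

end twoTorsionCurve

/-! ### Rational numbers with prescribed norms at the odd primes. -/

section PadicNorm

variable {p : ℕ} [hp : Fact p.Prime]

theorem padicNorm.two_pow (hp2 : p ≠ 2) (k : ℕ) : padicNorm p ((2 : ℚ) ^ k) = 1 := by
  have h : padicNorm p ((2 : ℕ) : ℚ) = 1 := by
    rw [padicNorm.nat_eq_one_iff]
    intro h
    exact hp2 ((Nat.prime_dvd_prime_iff_eq hp.out Nat.prime_two).1 h)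
  rw [padicNorm.pow]
  rw [Nat.cast_ofNat] at h
  rw [h, one_pow]

theorem padicNorm.two (hp2 : p ≠ 2) : padicNorm p 2 = 1 := by
  simpa using padicNorm.two_pow hp2 1

theorem padicNorm.four (hp2 : p ≠ 2) : padicNorm p 4 = 1 := by
  have := padicNorm.two_pow hp2 2
  rwa [show (2 : ℚ) ^ 2 = 4 by norm_num] at this

theorem padicNorm.den_eq_one {x : ℚ} (h : padicNorm p x ≤ 1) : padicNorm p (x.den : ℚ) = 1 := by
  rw [padicNorm.nat_eq_one_iff]
  intro hd
  have h1 : padicNorm p (x.num : ℚ) < 1 := by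
    rw [← Rat.mul_den_eq_num x, padicNorm.mul]
    have h2 : padicNorm p (x.den : ℚ) < 1 := (padicNorm.nat_lt_one_iff _).2 hd
    exact mul_lt_one_of_nonneg_of_lt_one_right h (padicNorm.nonneg _) h2
  rw [padicNorm.int_lt_one_iff] at h1
  have h3 : p ∣ x.num.natAbs := Int.natCast_dvd.1 h1
  have h4 := Nat.dvd_gcd h3 hd
  rw [x.reduced] at h4
  exact hp.out.one_lt.ne' (Nat.dvd_one.1 h4)

/-- Supplies the scale `g` for which the curve with coefficient `4 * c ^ 2` is integral and as
reduced as possible at `p`. -/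
theorem padicNorm.exists_div_sq (c : ℚ) (hc : c ≠ 0) :
    ∃ g : ℚ, g ≠ 0 ∧ (padicNorm p (c / g ^ 2) = 1 ∨ padicNorm p (c / g ^ 2) = (p : ℚ)⁻¹) := by
  have hp0 : (p : ℚ) ≠ 0 := by exact_mod_cast hp.out.ne_zero
  obtain ⟨v, hv⟩ := padicNorm.values_discrete (p := p) hc
  have hpow (k : ℤ) : padicNorm p ((p : ℚ) ^ k) = (p : ℚ) ^ (-k) := by
    rcases k with k | k
    · rw [Int.ofNat_eq_natCast, zpow_natCast, padicNorm.pow, padicNorm.padicNorm_p_of_prime,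
        inv_pow, zpow_neg, zpow_natCast]
    · rw [zpow_negSucc, Int.neg_negSucc, inv_eq_one_div, padicNorm.div, padicNorm.one,
        padicNorm.pow, padicNorm.padicNorm_p_of_prime, inv_pow, one_div, inv_inv]
      exact (zpow_natCast _ _).symm
  rcases Int.even_or_odd' v with ⟨k, rfl | rfl⟩
  · refine ⟨(p : ℚ) ^ k, by positivity, Or.inl ?_⟩
    rw [padicNorm.div, hv, padicNorm.pow, hpow, ← zpow_natCast, ← zpow_mul, ← zpow_sub₀ hp0]
    convert zpow_zero _
    push_cast
    ring
  · refine ⟨(p : ℚ) ^ k, by positivity, Or.inr ?_⟩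
    rw [padicNorm.div, hv, padicNorm.pow, hpow, ← zpow_natCast, ← zpow_mul, ← zpow_sub₀ hp0]
    convert zpow_neg_one _
    push_cast
    ring

end PadicNorm

theorem Nat.exists_eq_two_pow_of_padicNorm {n : ℕ}
    (h : ∀ p : ℕ, [Fact p.Prime] → p ≠ 2 → padicNorm p (n : ℚ) = 1) : ∃ k, n = 2 ^ k := by
  rcases Nat.eq_two_pow_or_exists_odd_prime_and_dvd n with h1 | ⟨p, hp, hpn, hodd⟩
  · exact h1
  · have := Fact.mk hp
    have h2 : p ≠ 2 := by
      rintro rfl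
      exact absurd hodd (by decide)
    exact absurd hpn ((padicNorm.nat_eq_one_iff n).1 (h p h2))

/-- A rational number that is a unit at all odd primes is a power of two up to sign. -/
theorem Rat.exists_eq_two_zpow_of_padicNorm {x : ℚ}
    (h : ∀ p : ℕ, [Fact p.Prime] → p ≠ 2 → padicNorm p x = 1) :
    ∃ k : ℤ, x = 2 ^ k ∨ x = -2 ^ k := by
  have hd (p : ℕ) [Fact p.Prime] (hp2 : p ≠ 2) : padicNorm p (x.den : ℚ) = 1 :=
    padicNorm.den_eq_one (h p hp2).le
  obtain ⟨j, hj⟩ := Nat.exists_eq_two_pow_of_padicNorm hd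
  obtain ⟨i, hi⟩ := Nat.exists_eq_two_pow_of_padicNorm (n := x.num.natAbs) (by
    intro p _ hp2
    have h1 : padicNorm p (x.num : ℚ) = 1 := by
      rw [← Rat.mul_den_eq_num x, padicNorm.mul, h p hp2, hd p hp2, one_mul]
    rw [padicNorm.int_eq_one_iff] at h1
    rwa [padicNorm.nat_eq_one_iff, ← Int.natCast_dvd])
  refine ⟨(i : ℤ) - j, ?_⟩
  rw [zpow_sub₀ two_ne_zero, zpow_natCast, zpow_natCast]
  have h2 : x = x.num / x.den := (Rat.num_div_den x).symm
  rw [h2, hj]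
  rcases Int.natAbs_eq x.num with h3 | h3 <;> rw [h3, hi] <;> push_cast
  · exact Or.inl rfl
  · exact Or.inr (neg_div _ _)

/-- For `x = n / d` in lowest terms, `n ^ 2 + d ^ 2` is a power of two. A sum of two coprime squares
is not divisible by four, so it is at most two. -/
theorem Rat.sq_eq_one_of_padicNorm {x : ℚ} (hx : x ≠ 0)
    (h : ∀ p : ℕ, [Fact p.Prime] → p ≠ 2 →
      padicNorm p x ≤ 1 ∧ padicNorm p (x ^ 2 + 1) = 1) : x ^ 2 = 1 := by
  obtain ⟨i, hi⟩ := Nat.exists_eq_two_pow_of_padicNorm (n := x.num.natAbs ^ 2 + x.den ^ 2) (by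
    intro p _ hp2
    have h1 : ((x.num.natAbs ^ 2 + x.den ^ 2 : ℕ) : ℚ) = (x ^ 2 + 1) * x.den ^ 2 := by
      rw [Nat.cast_add, Nat.cast_pow, Nat.cast_pow, Nat.cast_natAbs, Int.cast_abs, sq_abs,
        ← Rat.mul_den_eq_num x]
      ring
    rw [h1, padicNorm.mul, (h p hp2).2, padicNorm.pow, padicNorm.den_eq_one (h p hp2).1]
    norm_num)
  have hn : 0 < x.num.natAbs := Int.natAbs_pos.2 (Rat.num_ne_zero.2 hx)
  have hd : 0 < x.den := x.den_pos
  have hc := x.reduced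
  have hi2 : i < 2 := by
    by_contra! h2
    have h4 : 4 ∣ x.num.natAbs ^ 2 + x.den ^ 2 := by
      rw [hi]
      exact pow_dvd_pow 2 h2
    have h5 : 2 ∣ x.num.natAbs ∧ 2 ∣ x.den := by
      rcases Nat.even_or_odd' x.num.natAbs with ⟨m, hm | hm⟩ <;>
      rcases Nat.even_or_odd' x.den with ⟨n, hn | hn⟩
      · exact ⟨⟨m, hm⟩, ⟨n, hn⟩⟩
      all_goals
        exfalso
        rw [hm, hn] at h4
        ring_nf at h4
        omega
    have h6 := Nat.dvd_gcd h5.1 h5.2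
    rw [hc] at h6
    exact absurd h6 (by decide)
  have h7 : x.num.natAbs ^ 2 + x.den ^ 2 ≤ 2 := by
    rw [hi]
    interval_cases i <;> norm_num
  have h8 : x.num.natAbs = 1 := by nlinarith
  have h9 : x.den = 1 := by nlinarith
  have h10 : x = x.num := by
    conv_lhs => rw [← Rat.num_div_den x, h9]
    simp
  rw [h10, ← sq_abs, ← Int.cast_abs, Int.abs_eq_natAbs, h8]
  norm_num

/-! ### Torsion of `y ^ 2 = x ^ 3 + 4 * c ^ 2 * x`. -/

namespace twoTorsionCurve

variable {a b : ℚ}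

theorem exists_of_two_nsmul_ne_zero {P : (twoTorsionCurve a b).Point} (h : 2 • P ≠ 0) :
    ∃ x y h, P = Point.some x y h ∧ y ≠ 0 ∧ x ≠ 0 ∧
      ∃ y' h', 2 • P = Point.some ((x ^ 2 - b) ^ 2 / (4 * y ^ 2)) y' h' := by
  rcases P with _ | ⟨x, y, hP⟩
  · exact absurd (nsmul_zero 2) h
  · have hy : y ≠ 0 := by
      rintro rfl
      rw [two_nsmul, add_self_eq_zero] at h
      exact h rfl
    refine ⟨x, y, hP, rfl, hy, ?_, ?_⟩
    · rintro rfl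
      have := equation_iff.1 hP.1
      exact hy (by simpa using this)
    · rw [two_nsmul]
      exact add_self hP hy

/-- If two successive duplications of `x` on `y ^ 2 = x ^ 3 + 4 * c ^ 2 * x` stay integral at an
odd prime, where `x` is a square and `c` has order zero or one, then the first of them is a unit. -/
theorem padicNorm_of_dup {p : ℕ} [Fact p.Prime] (hp2 : p ≠ 2) {c s x₁ x₂ x₃ : ℚ}
    (hc : padicNorm p c = 1 ∨ padicNorm p c = (p : ℚ)⁻¹) (hs : s ≠ 0) (hx₁ : x₁ = s ^ 2)
    (hx₂ : x₂ = (x₁ ^ 2 - 4 * c ^ 2) ^ 2 / (4 * (x₁ * (x₁ ^ 2 + 4 * c ^ 2))))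
    (hx₃ : x₃ = (x₂ ^ 2 - 4 * c ^ 2) ^ 2 / (4 * (x₂ * (x₂ ^ 2 + 4 * c ^ 2)))) (hx₂0 : x₂ ≠ 0)
    (h₁ : padicNorm p x₁ ≤ 1) (h₂ : padicNorm p x₂ ≤ 1) (h₃ : padicNorm p x₃ ≤ 1) :
    padicNorm p (2 * c / x₂) ≤ 1 ∧ padicNorm p ((2 * c / x₂) ^ 2 + 1) = 1 := by
  have hpp : 1 < (p : ℚ) := by exact_mod_cast (Fact.out : p.Prime).one_lt
  have hpi : (p : ℚ)⁻¹ < 1 := inv_lt_one_of_one_lt₀ hpp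
  have hpi0 : 0 < (p : ℚ)⁻¹ := by positivity
  have h4 := padicNorm.four (p := p) hp2
  have hc4 : padicNorm p (4 * c ^ 2) = padicNorm p c ^ 2 := by
    rw [padicNorm.mul, h4, one_mul, padicNorm.pow]
  have hpos {x : ℚ} (hx : x ≠ 0) : 0 < padicNorm p x :=
    lt_of_le_of_ne (padicNorm.nonneg x) (padicNorm.nonzero hx).symm
  suffices h : padicNorm p x₂ = 1 ∧ padicNorm p (x₂ ^ 2 + 4 * c ^ 2) = 1 by
    constructor
    · rw [padicNorm.div, h.1, padicNorm.mul, padicNorm.two hp2]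
      rcases hc with hc | hc <;> rw [hc] <;> linarith
    · have : (2 * c / x₂) ^ 2 + 1 = (x₂ ^ 2 + 4 * c ^ 2) / x₂ ^ 2 := by
        field_simp
        ring
      rw [this, padicNorm.div, padicNorm.pow, h.1, h.2]
      norm_num
  have hs₁ : x₁ ≠ 0 := by rw [hx₁]; positivity
  have sub_add (x : ℚ) (h : padicNorm p x ≠ padicNorm p c) :
      padicNorm p (x ^ 2 + 4 * c ^ 2) = max (padicNorm p x) (padicNorm p c) ^ 2 ∧
      padicNorm p (x ^ 2 - 4 * c ^ 2) = max (padicNorm p x) (padicNorm p c) ^ 2 := by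
    have hn := padicNorm.nonneg (p := p) x
    have hn' := padicNorm.nonneg (p := p) c
    have hne : padicNorm p (x ^ 2) ≠ padicNorm p (4 * c ^ 2) := by
      rw [hc4, padicNorm.pow]
      exact fun h0 => h ((pow_left_inj₀ hn hn' two_ne_zero).1 h0)
    have hmax : max (padicNorm p (x ^ 2)) (padicNorm p (4 * c ^ 2))
        = max (padicNorm p x) (padicNorm p c) ^ 2 := by
      rw [hc4, padicNorm.pow]
      rcases le_total (padicNorm p x) (padicNorm p c) with h0 | h0
      · rw [max_eq_right h0, max_eq_right (pow_le_pow_left₀ hn h0 2)]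
      · rw [max_eq_left h0, max_eq_left (pow_le_pow_left₀ hn' h0 2)]
    refine ⟨by rw [padicNorm.add_eq_max_of_ne hne, hmax], ?_⟩
    rw [sub_eq_add_neg, padicNorm.add_eq_max_of_ne, padicNorm.neg, hmax]
    rwa [padicNorm.neg]
  have hdup (x : ℚ) : padicNorm p ((x ^ 2 - 4 * c ^ 2) ^ 2 / (4 * (x * (x ^ 2 + 4 * c ^ 2))))
      = padicNorm p (x ^ 2 - 4 * c ^ 2) ^ 2 / (padicNorm p x * padicNorm p (x ^ 2 + 4 * c ^ 2)) := by
    rw [padicNorm.div, padicNorm.pow, padicNorm.mul 4, h4, one_mul, padicNorm.mul x]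
  rcases hc with hc | hc
  -- For a unit `c`, `|x₂| < 1` would give `|x₃| = 1 / |x₂| > 1`.
  · have h2 : padicNorm p x₂ = 1 := by
      by_contra hne
      obtain ⟨h5, h6⟩ := sub_add x₂ (by rwa [hc])
      rw [hx₃, hdup, h5, h6, hc, max_eq_right h₂, one_pow, one_pow, mul_one, div_le_one (hpos hx₂0)]
        at h₃
      exact hne (le_antisymm h₂ h₃)
    refine ⟨h2, ?_⟩
    have hle : padicNorm p (x₂ ^ 2 + 4 * c ^ 2) ≤ 1 := by
      refine padicNorm.add_le_of_le ?_ ?_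
      · rw [padicNorm.pow, h2, one_pow]
      · rw [hc4, hc, one_pow]
    by_contra hne
    have hlt := lt_of_le_of_ne hle hne
    -- The sum and the difference of `x₂ ^ 2` and `4 * c ^ 2` differ by the unit `8 * c ^ 2`. If the
    -- sum is not a unit, the difference is, and `x₃` is not integral.
    have h5 : padicNorm p (x₂ ^ 2 - 4 * c ^ 2) = 1 := by
      have h6 : x₂ ^ 2 - 4 * c ^ 2 = -(2 * (4 * c ^ 2) - (x₂ ^ 2 + 4 * c ^ 2)) := by ring
      have h7 : padicNorm p (2 * (4 * c ^ 2)) = 1 := by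
        rw [padicNorm.mul, padicNorm.two hp2, hc4, hc]
        norm_num
      rw [h6, padicNorm.neg, padicNorm.sub_eq_left_of_lt (by rwa [h7]), h7]
    rw [hx₃, hdup, h5, h2, one_mul, one_pow] at h₃
    have h8 : x₂ ^ 2 + 4 * c ^ 2 ≠ 0 := by positivity
    rw [div_le_one (hpos h8)] at h₃
    exact hne (le_antisymm hle h₃)
  -- Here `|c| = 1 / p`. As `x₁` is a square, either `|x₁| = 1`, or `|x₁| ≤ 1 / p ^ 2` and then
  -- `|x₂| = |c| ^ 2 / |x₁| ≥ 1`.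
  · have h2 : padicNorm p x₂ = 1 := by
      refine le_antisymm h₂ ?_
      rcases eq_or_lt_of_le h₁ with h1 | h1
      · obtain ⟨h5, h6⟩ := sub_add x₁ (by rw [h1, hc]; exact hpi.ne')
        rw [hx₂, hdup, h5, h6, h1, hc, max_eq_left hpi.le]
        norm_num
      · have h3 : padicNorm p x₁ ≤ (p : ℚ)⁻¹ ^ 2 := by
          rw [hx₁, padicNorm.pow] at h1 ⊢
          exact pow_le_pow_left₀ (padicNorm.nonneg _) (padicNorm.le_inv_of_lt_one
            ((pow_lt_one_iff_of_nonneg (padicNorm.nonneg _) two_ne_zero).1 h1)) 2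
        have h7 : padicNorm p x₁ < (p : ℚ)⁻¹ := h3.trans_lt (by nlinarith)
        obtain ⟨h5, h6⟩ := sub_add x₁ (by rw [hc]; exact h7.ne)
        have hx₁p := hpos hs₁
        rw [hx₂, hdup, h5, h6, hc, max_eq_right h7.le, one_le_div (by positivity)]
        calc padicNorm p x₁ * (p : ℚ)⁻¹ ^ 2 ≤ (p : ℚ)⁻¹ ^ 2 * (p : ℚ)⁻¹ ^ 2 := by gcongr
          _ = _ := by ring
    refine ⟨h2, ?_⟩
    rw [(sub_add x₂ (by rw [h2, hc]; exact hpi.ne')).1, h2, hc, max_eq_left hpi.le, one_pow]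

theorem dup_div {c g x : ℚ} (hg : g ≠ 0) (hc : c ≠ 0) :
    ((x / g ^ 2) ^ 2 - 4 * (c / g ^ 2) ^ 2) ^ 2
        / (4 * (x / g ^ 2 * ((x / g ^ 2) ^ 2 + 4 * (c / g ^ 2) ^ 2)))
      = (x ^ 2 - 4 * c ^ 2) ^ 2 / (4 * (x * (x ^ 2 + 4 * c ^ 2))) / g ^ 2 := by
  rcases eq_or_ne x 0 with rfl | hx
  · simp
  have h1 : (x / g ^ 2) ^ 2 + 4 * (c / g ^ 2) ^ 2 = (x ^ 2 + 4 * c ^ 2) / g ^ 4 := by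
    field_simp
  have h2 : (x / g ^ 2) ^ 2 - 4 * (c / g ^ 2) ^ 2 = (x ^ 2 - 4 * c ^ 2) / g ^ 4 := by
    field_simp
  have h3 : x ^ 2 + 4 * c ^ 2 ≠ 0 := by positivity
  rw [h1, h2]
  generalize x ^ 2 + 4 * c ^ 2 = A at *
  generalize x ^ 2 - 4 * c ^ 2 = B at *
  field_simp

section

variable {c : ℚ} (hc : ∀ s : ℚ, s ^ 2 ≠ c ∧ s ^ 2 ≠ -c)

include hc

/-- The abscissae `±2c` belong to the halves of `(0, 0)`; there `y ^ 2 = ±16 * c ^ 3`, so `c` or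
`-c` would be a square. -/
theorem sq_ne_four_mul_sq {x y : ℚ} (h : (twoTorsionCurve 0 (4 * c ^ 2)).Nonsingular x y) :
    x ^ 2 ≠ 4 * c ^ 2 := by
  intro hx
  have h1 := equation_iff.1 h.1
  have hc0 : c ≠ 0 := fun h0 => (hc 0).1 (by rw [h0]; norm_num)
  have h2 : (x - 2 * c) * (x + 2 * c) = 0 := by linear_combination hx
  rcases mul_eq_zero.1 h2 with h3 | h3
  · have hx' : x = 2 * c := by linarith
    refine (hc (y / (4 * c))).1 ?_
    rw [div_pow, h1, hx']
    field_simp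
    ring
  · have hx' : x = -(2 * c) := by linarith
    refine (hc (y / (4 * c))).2 ?_
    rw [div_pow, h1, hx']
    field_simp
    ring

/-- The abscissa of a nonzero double is a nonzero square, hence positive, whereas the only rational
point of order two is `(0, 0)`. -/
theorem two_nsmul_two_nsmul_ne_zero {P : (twoTorsionCurve 0 (4 * c ^ 2)).Point}
    (h : 2 • P ≠ 0) : 2 • 2 • P ≠ 0 := by
  obtain ⟨x, y, hP, rfl, hy, -, y', h', h2⟩ := exists_of_two_nsmul_ne_zero h
  rw [h2, two_nsmul]
  intro h3
  have h4 := eq_neg_of_add_eq_zero_left h3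
  rw [Point.neg_some, Point.some.injEq, negY_eq] at h4
  have hy' : y' = 0 := by linarith [h4.2]
  subst hy'
  have h5 := equation_iff.1 h'.1
  have h6 : (x ^ 2 - 4 * c ^ 2) ^ 2 / (4 * y ^ 2) ≠ 0 := by
    have := sub_ne_zero.2 (sq_ne_four_mul_sq hc hP)
    positivity
  have h7 : 0 < (x ^ 2 - 4 * c ^ 2) ^ 2 / (4 * y ^ 2) := lt_of_le_of_ne (by positivity) h6.symm
  generalize (x ^ 2 - 4 * c ^ 2) ^ 2 / (4 * y ^ 2) = X at *
  have : 0 < X ^ 3 := by positivity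
  nlinarith [mul_nonneg (sq_nonneg c) h7.le]

/-- The rational points of finite order on `y ^ 2 = x ^ 3 + 4 * c ^ 2 * x` are killed by two, if
neither `c` nor `-c` is a square. -/
theorem two_nsmul_eq_zero_of_isOfFinAddOrder {P : (twoTorsionCurve 0 (4 * c ^ 2)).Point}
    (hP : IsOfFinAddOrder P) : 2 • P = 0 := by
  by_contra h
  have hc0 : c ≠ 0 := fun h0 => (hc 0).1 (by rw [h0]; norm_num)
  have h₂ := two_nsmul_two_nsmul_ne_zero hc h
  have h₃ := two_nsmul_two_nsmul_ne_zero hc h₂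
  obtain ⟨x, y, hns, rfl, hy, -, y₁, hns₁, e₁⟩ := exists_of_two_nsmul_ne_zero h
  have hf₁ : IsOfFinAddOrder (2 • Point.some x y hns) := hP.nsmul
  have hf₂ : IsOfFinAddOrder (2 • 2 • Point.some x y hns) := hf₁.nsmul
  have hf₃ : IsOfFinAddOrder (2 • 2 • 2 • Point.some x y hns) := hf₂.nsmul
  obtain ⟨x₁, _, _, e₁', hy₁, hx₁, y₂, hns₂, e₂⟩ := exists_of_two_nsmul_ne_zero h₂
  have E₁ := e₁'.symm.trans e₁
  rw [Point.some.injEq] at E₁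
  obtain ⟨hX₁, rfl⟩ := E₁
  obtain ⟨x₂, _, _, e₂', hy₂, hx₂, y₃, hns₃, e₃⟩ := exists_of_two_nsmul_ne_zero h₃
  have E₂ := e₂'.symm.trans e₂
  rw [Point.some.injEq] at E₂
  obtain ⟨hX₂, rfl⟩ := E₂
  rw [e₁'] at hf₁
  rw [e₂'] at hf₂
  rw [e₃] at hf₃
  rename_i hns₁' _ hns₂'
  have q₁ := equation_iff.1 hns₁'.1
  have q₂ := equation_iff.1 hns₂'.1
  set s := (x ^ 2 - 4 * c ^ 2) / (2 * y) with hs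
  have hs0 : s ≠ 0 := by
    have := sub_ne_zero.2 (sq_ne_four_mul_sq hc hns)
    positivity
  have hX₁s : x₁ = s ^ 2 := by
    rw [hX₁, hs]
    field_simp
    ring
  -- `x₁`, `x₂`, `x₃` (given by `e₃`) are the abscissae of `2P`, `4P`, `8P`, integral at each odd
  -- prime after scaling. The conclusion `x₂ ^ 2 = 4 * c ^ 2` has just been excluded.
  have key : (2 * c / x₂) ^ 2 = 1 := by
    refine Rat.sq_eq_one_of_padicNorm (by positivity) ?_
    intro p _ hp2
    obtain ⟨g, hg, hcg⟩ := padicNorm.exists_div_sq (p := p) c hc0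
    have hg0 : 0 < padicNorm p g :=
      lt_of_le_of_ne (padicNorm.nonneg g) (padicNorm.nonzero hg).symm
    have hb : padicNorm p (4 * c ^ 2) ≤ padicNorm p g ^ 4 := by
      have h1 : (4 * c ^ 2 : ℚ) = 4 * (c / g ^ 2) ^ 2 * g ^ 4 := by
        field_simp
      have h2 : padicNorm p (c / g ^ 2) ≤ 1 := by
        rcases hcg with h2 | h2 <;> rw [h2]
        exact inv_le_one_of_one_le₀ (by exact_mod_cast (Fact.out : p.Prime).one_le)
      rw [h1, padicNorm.mul, padicNorm.mul, padicNorm.four hp2, padicNorm.pow, padicNorm.pow]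
      refine (mul_le_mul_of_nonneg_right ?_ (by positivity)).trans_eq (one_mul _)
      rw [one_mul]
      exact pow_le_one₀ (padicNorm.nonneg _) h2
    have ha : padicNorm p 0 ≤ padicNorm p g ^ 2 := by
      rw [padicNorm.zero]
      positivity
    have hint {x y : ℚ} {h : (twoTorsionCurve 0 (4 * c ^ 2)).Nonsingular x y}
        (hf : IsOfFinAddOrder (Point.some x y h)) : padicNorm p (x / g ^ 2) ≤ 1 := by
      rw [padicNorm.div, padicNorm.pow, div_le_one (by positivity)]
      exact padicNorm_le_of_isOfFinAddOrder hg ha hb hf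
    have hres := padicNorm_of_dup hp2 (c := c / g ^ 2) (s := s / g) (x₁ := x₁ / g ^ 2)
      (x₂ := x₂ / g ^ 2) hcg (by positivity) (by rw [div_pow, ← hX₁s]) ?_ rfl (by positivity)
      (hint hf₁) (hint hf₂) ?_
    · have h1 : 2 * (c / g ^ 2) / (x₂ / g ^ 2) = 2 * c / x₂ := by
        field_simp
      rwa [h1] at hres
    · rw [dup_div hg hc0, hX₂, q₁]
      ring_nf
    · rw [dup_div hg hc0]
      convert hint hf₃ using 4
      rw [q₂]
      ring
  refine sq_ne_four_mul_sq hc hns₂' ?_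
  rw [div_pow, div_eq_one_iff_eq (by positivity)] at key
  linarith

end

end twoTorsionCurve

/-! ### Torsion of the Legendre curve of `r ^ 4`. -/

theorem padicNorm.den_mul_max {p : ℕ} [hp : Fact p.Prime] (x : ℚ) :
    padicNorm p (x.den : ℚ) * max 1 (padicNorm p x) = 1 := by
  rcases le_or_gt (padicNorm p x) 1 with h | h
  · rw [padicNorm.den_eq_one h, max_eq_left h, mul_one]
  · rw [max_eq_right h.le, ← padicNorm.mul, mul_comm, Rat.mul_den_eq_num, padicNorm.int_eq_one_iff]
    intro hn
    have hx0 : 0 < padicNorm p (x.den : ℚ) := lt_of_le_of_ne (padicNorm.nonneg _)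
      (padicNorm.nonzero (by exact_mod_cast x.den_ne_zero)).symm
    have h1 : padicNorm p (x.den : ℚ) < 1 := by
      have h2 := (padicNorm.int_lt_one_iff (p := p) _).2 hn
      rw [← Rat.mul_den_eq_num x, padicNorm.mul] at h2
      nlinarith
    have h3 := Nat.dvd_gcd (Int.natCast_dvd.1 hn) ((padicNorm.nat_lt_one_iff _).1 h1)
    rw [x.reduced] at h3
    exact hp.out.one_lt.ne' (Nat.dvd_one.1 h3)

theorem max_pow_eq {x y : ℚ} (hx : 0 ≤ x) (hy : 0 ≤ y) (n : ℕ) :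
    max x y ^ n = max (x ^ n) (y ^ n) := by
  rcases le_total x y with h | h
  · rw [max_eq_right h, max_eq_right (pow_le_pow_left₀ hx h n)]
  · rw [max_eq_left h, max_eq_left (pow_le_pow_left₀ hy h n)]

namespace twoTorsionCurve

theorem legendre_equation_iff {l x y : ℚ} :
    (twoTorsionCurve (-(1 + l)) l).Equation x y ↔ y ^ 2 = x * (x - 1) * (x - l) := by
  rw [equation_iff]
  constructor <;> intro h <;> linear_combination h

theorem exists_sq_of_two_nsmul_ne_zero {l : ℚ} {P : (twoTorsionCurve (-(1 + l)) l).Point}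
    (h : 2 • P ≠ 0) : ∃ x y h s t v, 2 • P = Point.some x y h ∧
      x = s ^ 2 ∧ x - 1 = t ^ 2 ∧ x - l = v ^ 2 := by
  obtain ⟨x, y, hP, rfl, hy, -, y', h', h2⟩ := exists_of_two_nsmul_ne_zero h
  have h1 := legendre_equation_iff.1 hP.1
  refine ⟨_, _, _, (x ^ 2 - l) / (2 * y), (x ^ 2 - 2 * x + l) / (2 * y),
    (x ^ 2 - 2 * l * x + l) / (2 * y), h2, ?_, ?_, ?_⟩
  · field_simp
    ring
  · field_simp
    linear_combination -16 * h1
  · field_simp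
    linear_combination -16 * l * h1

variable {r : ℚ}

/-- Equality would make `-1`, `1 - r ^ 4` or `r ^ 4 - 1` a square. Hence no double is a point of
order two. -/
theorem ne_of_sub_eq_sq (hr : Admissible r) {x s t v : ℚ} (hs : x = s ^ 2) (ht : x - 1 = t ^ 2)
    (hv : x - r ^ 4 = v ^ 2) : x ≠ 0 ∧ x ≠ 1 ∧ x ≠ r ^ 4 := by
  refine ⟨?_, ?_, ?_⟩
  · rintro rfl
    nlinarith [sq_nonneg t]
  · rintro rfl
    refine Rat.four_sub_four_ne_sq (x := 1) (z := v) hr.1 ?_ (by linarith)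
    rintro rfl
    exact hr.sub_ne_zero (by linarith)
  · intro h
    refine Rat.four_sub_four_ne_sq (x := r) (y := 1) (z := t) one_ne_zero ?_ (by rw [← ht, h]; ring)
    rintro rfl
    exact hr.sub_ne_zero (by rw [← h]; linarith)

theorem legendre_two_nsmul_two_nsmul_ne_zero (hr : Admissible r)
    {P : (twoTorsionCurve (-(1 + r ^ 4)) (r ^ 4)).Point} (h : 2 • P ≠ 0) : 2 • 2 • P ≠ 0 := by
  obtain ⟨x, y, hP, s, t, v, h2, hs, ht, hv⟩ := exists_sq_of_two_nsmul_ne_zero h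
  obtain ⟨h0, h1, h3⟩ := ne_of_sub_eq_sq hr hs ht hv
  rw [h2, two_nsmul]
  intro h4
  have h5 := eq_neg_of_add_eq_zero_left h4
  rw [Point.neg_some, Point.some.injEq, negY_eq] at h5
  have hy : y = 0 := by linarith [h5.2]
  subst hy
  have h6 := legendre_equation_iff.1 hP.1
  have h7 : x * (x - 1) * (x - r ^ 4) ≠ 0 :=
    mul_ne_zero (mul_ne_zero h0 (sub_ne_zero.2 h1)) (sub_ne_zero.2 h3)
  exact h7 (by rw [← h6]; norm_num)

theorem two_nsmul_eq_zero_of_two_pow (hr : Admissible r) (e : ℕ)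
    {P : (twoTorsionCurve (-(1 + r ^ 4)) (r ^ 4)).Point} (h : 2 ^ e • P = 0) : 2 • P = 0 := by
  induction e generalizing P with
  | zero =>
    rw [pow_zero, one_nsmul] at h
    rw [h, nsmul_zero]
  | succ e ih =>
    rw [pow_succ 2 e, mul_smul] at h
    by_contra h2
    exact legendre_two_nsmul_two_nsmul_ne_zero hr h2 (ih h)

/-- A point of finite order is the sum of a double and of a point of order at most two. -/
theorem exists_add_eq_two_nsmul (hr : Admissible r)
    {P : (twoTorsionCurve (-(1 + r ^ 4)) (r ^ 4)).Point} (hP : IsOfFinAddOrder P) :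
    ∃ T R : (twoTorsionCurve (-(1 + r ^ 4)) (r ^ 4)).Point, 2 • T = 0 ∧ P + T = 2 • R := by
  obtain ⟨e, k, ⟨j, rfl⟩, hk⟩ := Nat.exists_eq_two_pow_mul_odd hP.addOrderOf_pos.ne'
  -- The order is `2 ^ e * (2 * j + 1)`, so `(2 * j + 1) • P` is killed by a power of two, hence by
  -- two.
  refine ⟨(2 * j + 1) • P, (j + 1) • P, two_nsmul_eq_zero_of_two_pow hr e ?_, ?_⟩
  · rw [smul_smul, ← hk, addOrderOf_nsmul_eq_zero]
  · rw [smul_smul, ← succ_nsmul']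
    congr 1

theorem eq_zero_or_of_two_nsmul_eq_zero {l : ℚ} {T : (twoTorsionCurve (-(1 + l)) l).Point}
    (h : 2 • T = 0) : T = 0 ∨ ∃ e h, T = Point.some e 0 h ∧ (e = 0 ∨ e = 1 ∨ e = l) := by
  rcases T with _ | ⟨x, y, hT⟩
  · exact Or.inl rfl
  · right
    rw [two_nsmul] at h
    have h5 := eq_neg_of_add_eq_zero_left h
    rw [Point.neg_some, Point.some.injEq, negY_eq] at h5
    have hy : y = 0 := by linarith [h5.2]
    subst hy
    refine ⟨x, hT, rfl, ?_⟩
    have h6 := legendre_equation_iff.1 hT.1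
    have h7 : x * (x - 1) * (x - l) = 0 := by rw [← h6]; norm_num
    rcases mul_eq_zero.1 h7 with h8 | h8
    · rcases mul_eq_zero.1 h8 with h9 | h9
      · exact Or.inl h9
      · exact Or.inr (Or.inl (by linarith))
    · exact Or.inr (Or.inr (by linarith))

/-- The square classes forced on a point of finite order whose abscissa is a fourth power. -/
theorem sq_classes_of_isOfFinAddOrder (hr : Admissible r) {u y : ℚ} (hu : Admissible u) (hy : y ≠ 0)
    {h : (twoTorsionCurve (-(1 + r ^ 4)) (r ^ 4)).Nonsingular (u ^ 4) y}
    (hf : IsOfFinAddOrder (Point.some (u ^ 4) y h)) :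
    ∃ z, z ≠ 0 ∧ (z ^ 2 = (1 - r ^ 4) * (u ^ 4 - 1) ∨ z ^ 2 = (r ^ 4 - 1) * (u ^ 4 - r ^ 4)) := by
  have heq := legendre_equation_iff.1 h.1
  have hu0 := hu.1
  have hr0 := hr.1
  have hu1 := hu.sub_ne_zero
  have hr1 := hr.sub_ne_zero
  have hur : u ^ 4 - r ^ 4 ≠ 0 := by
    intro h0
    rw [h0, mul_zero] at heq
    exact hy (by simpa using heq)
  obtain ⟨T, R, hT, hR⟩ := exists_add_eq_two_nsmul hr hf
  have hQT : Point.some (u ^ 4) y h + T ≠ 0 := by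
    intro h0
    have h1 : (2 : ℕ) • Point.some (u ^ 4) y h = 0 := by
      rw [eq_neg_of_add_eq_zero_left h0, neg_nsmul, hT, neg_zero]
    rcases eq_zero_or_of_two_nsmul_eq_zero h1 with h2 | ⟨e, he, h2, -⟩
    · exact Point.some_ne_zero _ h2
    · rw [Point.some.injEq] at h2
      exact hy h2.2
  obtain ⟨X, Y, hX, s, t, v, hXR, hs, ht, hv⟩ := exists_sq_of_two_nsmul_ne_zero (hR ▸ hQT)
  obtain ⟨hX0, hX1, hXr⟩ := ne_of_sub_eq_sq hr hs ht hv
  have ht0 : t ≠ 0 := by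
    rintro rfl
    exact hX1 (by linarith)
  have hv0 : v ≠ 0 := by
    rintro rfl
    exact hXr (by linarith)
  have hsum := hR.trans hXR
  -- Translation by `T = (e, 0)` satisfies `(x(Q + T) - e) * (x(Q) - e) = (e - e') * (e - e'')`,
  -- with `e'`, `e''` the other roots. For `T = 0` and `T = (0, 0)` Fermat's theorem is
  -- contradicted; the other two roots give the two alternatives.
  rcases eq_zero_or_of_two_nsmul_eq_zero hT with rfl | ⟨e, he, rfl, h2⟩
  · rw [add_zero, Point.some.injEq] at hsum
    exfalso
    refine Rat.four_sub_four_ne_sq (x := u) (y := 1) one_ne_zero ht0 ?_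
    rw [← ht, hsum.1]
    ring
  · have hne : u ^ 4 ≠ e := by
      rcases h2 with rfl | rfl | rfl
      · positivity
      · exact sub_ne_zero.1 hu1
      · exact sub_ne_zero.1 hur
    obtain ⟨y', h', hadd⟩ := add_of_ne h he hne
    have hX' := hadd.symm.trans hsum
    rw [Point.some.injEq, sub_zero, div_pow, heq] at hX'
    replace hX' := hX'.1
    rcases h2 with rfl | rfl | rfl
    · exfalso
      refine Rat.four_sub_four_ne_sq (x := r) (y := u) (z := t * u ^ 2) hu0 (by positivity) ?_
      rw [mul_pow, ← ht, ← hX']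
      field_simp
      ring
    · refine ⟨t * (u ^ 4 - 1), mul_ne_zero ht0 hu1, Or.inl ?_⟩
      rw [mul_pow, ← ht, ← hX']
      field_simp
      ring
    · refine ⟨v * (u ^ 4 - r ^ 4) / r ^ 2, by positivity, Or.inr ?_⟩
      rw [div_pow, mul_pow, ← hv, ← hX']
      field_simp
      ring

/-- If the duplicate of a point with abscissa `U` on `y ^ 2 = x * (x - 1) * (x - l)` is integral at
an odd prime, then `U - 1` and `1 - l / U` have the same numerator there. -/
theorem padicNorm_sub_of_dup {p : ℕ} [Fact p.Prime] {U l : ℚ} (hU : U ≠ 0)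
    (hU1 : padicNorm p U ≤ 1) (hl1 : padicNorm p l ≤ 1)
    (h : padicNorm p (U ^ 2 - l) ^ 2
      ≤ padicNorm p U * padicNorm p (U - 1) * padicNorm p (U - l)) :
    padicNorm p (U - 1) * max (padicNorm p U) (padicNorm p l) = padicNorm p (U - l) := by
  have hU0 : 0 < padicNorm p U :=
    lt_of_le_of_ne (padicNorm.nonneg U) (padicNorm.nonzero hU).symm
  have hone (hlt : padicNorm p U < 1) : padicNorm p (U - 1) = 1 := by
    rw [← padicNorm.neg, neg_sub, padicNorm.sub_eq_left_of_lt (by rwa [padicNorm.one]),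
      padicNorm.one]
  rcases lt_trichotomy (padicNorm p U) (padicNorm p l) with hlt | heq | hlt
  · rw [hone (hlt.trans_le hl1), one_mul, max_eq_right hlt.le, ← padicNorm.neg (U - l),
      neg_sub, padicNorm.sub_eq_left_of_lt hlt]
  · rw [← heq, max_self]
    have hle : padicNorm p (U - l) ≤ padicNorm p U := padicNorm.sub_le_of_le le_rfl heq.ge
    rcases eq_or_lt_of_le hU1 with h1 | h1
    · rw [h1, one_mul] at h
      rw [h1, mul_one]
      by_contra hne
      have e : U ^ 2 - l = U * (U - 1) + (U - l) := by ring
      have hm : padicNorm p (U * (U - 1)) = padicNorm p (U - 1) := by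
        rw [padicNorm.mul, h1, one_mul]
      rw [e, padicNorm.add_eq_max_of_ne (by rwa [hm]), hm] at h
      have n1 := padicNorm.nonneg (p := p) (U - 1)
      have n2 := padicNorm.nonneg (p := p) (U - l)
      rcases lt_or_gt_of_ne hne with h2 | h2
      · rw [max_eq_right h2.le] at h
        nlinarith
      · rw [max_eq_left h2.le] at h
        nlinarith
    · rw [hone h1, one_mul]
      refine le_antisymm ?_ hle
      have h2 : padicNorm p (U ^ 2 - l) = padicNorm p U := by
        rw [← padicNorm.neg, neg_sub, padicNorm.sub_eq_left_of_lt, heq]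
        rw [padicNorm.pow, ← heq]
        nlinarith
      rw [h2, hone h1, mul_one] at h
      exact le_of_mul_le_mul_left (by linarith) hU0
  · rw [max_eq_left hlt.le, padicNorm.sub_eq_left_of_lt hlt]
    rcases eq_or_lt_of_le hU1 with h1 | h1
    · rw [h1, mul_one]
      have h2 : padicNorm p (U ^ 2 - l) = 1 := by
        rw [padicNorm.sub_eq_left_of_lt, padicNorm.pow, h1, one_pow]
        rw [padicNorm.pow, h1, one_pow]
        linarith
      rw [h2, padicNorm.sub_eq_left_of_lt hlt, h1] at h
      refine le_antisymm ?_ (by linarith)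
      exact padicNorm.sub_le_of_le hU1 padicNorm.one.le
    · rw [hone h1, one_mul]

theorem padicNorm_sub_of_isOfFinAddOrder {p : ℕ} [Fact p.Prime] (hp2 : p ≠ 2) {l : ℚ} (hl : l ≠ 0)
    {g : ℚ} (hgl : g ^ 2 = l)
    {U y : ℚ} (hU : U ≠ 0) (hy : y ≠ 0) {h : (twoTorsionCurve (-(1 + l)) l).Nonsingular U y}
    (hf : IsOfFinAddOrder (Point.some U y h)) :
    padicNorm p (U - 1) * max (padicNorm p U) (padicNorm p l)
      = padicNorm p (U - l) * max 1 (padicNorm p U) := by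
  have heq := legendre_equation_iff.1 h.1
  obtain ⟨y', h', hdbl⟩ := add_self h hy
  have hf2 : IsOfFinAddOrder (Point.some U y h + Point.some U y h) := by
    rw [← two_nsmul]
    exact hf.nsmul
  rw [hdbl] at hf2
  have hpos {x : ℚ} (hx : x ≠ 0) : 0 < padicNorm p x :=
    lt_of_le_of_ne (padicNorm.nonneg x) (padicNorm.nonzero hx).symm
  have hg : g ≠ 0 := by
    rintro rfl
    exact hl (by simpa using hgl.symm)
  have hdup : padicNorm p ((U ^ 2 - l) ^ 2 / (4 * y ^ 2)) * (padicNorm p U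
      * padicNorm p (U - 1) * padicNorm p (U - l)) = padicNorm p (U ^ 2 - l) ^ 2 := by
    have h1 : padicNorm p y ^ 2 = padicNorm p U * padicNorm p (U - 1) * padicNorm p (U - l) := by
      rw [← padicNorm.pow, heq, padicNorm.mul, padicNorm.mul]
    have h2 := hpos hy
    rw [padicNorm.div, padicNorm.mul, padicNorm.four hp2, one_mul, padicNorm.pow, padicNorm.pow,
      ← h1]
    field_simp
  have hn : 0 ≤ padicNorm p U * padicNorm p (U - 1) * padicNorm p (U - l) :=
    mul_nonneg (mul_nonneg (padicNorm.nonneg _) (padicNorm.nonneg _)) (padicNorm.nonneg _)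
  rcases le_or_gt (padicNorm p l) 1 with hl1 | hl1
  · have ha : padicNorm p (-(1 + l)) ≤ padicNorm p 1 ^ 2 := by
      rw [padicNorm.neg, padicNorm.one, one_pow]
      exact padicNorm.add_le_of_le padicNorm.one.le hl1
    have hb : padicNorm p l ≤ padicNorm p 1 ^ 4 := by rwa [padicNorm.one, one_pow]
    have i1 := padicNorm_le_of_isOfFinAddOrder one_ne_zero ha hb hf
    have i2 := padicNorm_le_of_isOfFinAddOrder one_ne_zero ha hb hf2
    rw [padicNorm.one, one_pow] at i1 i2
    rw [padicNorm_sub_of_dup hU i1 hl1, max_eq_left i1, mul_one]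
    rw [← hdup]
    exact mul_le_of_le_one_left hn i2
  -- For large `l`, scaling by `g` replaces `(U, l)` by `(U / l, 1 / l)`. This interchanges the
  -- roots `1` and `l`, and the claim is symmetric under it.
  · have hgl' : padicNorm p g ^ 2 = padicNorm p l := by rw [← padicNorm.pow, hgl]
    have ha : padicNorm p (-(1 + l)) ≤ padicNorm p g ^ 2 := by
      rw [padicNorm.neg, hgl']
      exact padicNorm.add_le_of_le (by rw [padicNorm.one]; exact hl1.le) le_rfl
    have hb : padicNorm p l ≤ padicNorm p g ^ 4 := by
      rw [show padicNorm p g ^ 4 = (padicNorm p g ^ 2) ^ 2 by ring, hgl']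
      nlinarith
    have i1 := padicNorm_le_of_isOfFinAddOrder hg ha hb hf
    have i2 := padicNorm_le_of_isOfFinAddOrder hg ha hb hf2
    rw [hgl'] at i1 i2
    have hlp := hpos hl
    have key := padicNorm_sub_of_dup (p := p) (U := U / l) (l := 1 / l) (by positivity)
      (by rw [padicNorm.div]; exact (div_le_one hlp).2 i1)
      (by rw [padicNorm.div, padicNorm.one]; exact (div_le_one hlp).2 hl1.le) ?_
    · rw [show U / l - 1 = (U - l) / l by field_simp, show U / l - 1 / l = (U - 1) / l by ring,
        padicNorm.div, padicNorm.div, padicNorm.div, padicNorm.div, padicNorm.one,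
        max_div_div_right hlp.le] at key
      rw [max_eq_right i1, max_comm 1]
      field_simp at key
      linarith
    · rw [show U / l - 1 = (U - l) / l by field_simp, show U / l - 1 / l = (U - 1) / l by ring,
        show (U / l) ^ 2 - 1 / l = (U ^ 2 - l) / l ^ 2 by field_simp,
        padicNorm.div, padicNorm.div, padicNorm.div, padicNorm.div, padicNorm.pow, div_pow, ← hdup,
        div_le_iff₀ (by positivity)]
      calc _ ≤ padicNorm p l * (padicNorm p U * padicNorm p (U - 1) * padicNorm p (U - l)) :=
            mul_le_mul_of_nonneg_right i2 hn
        _ = _ := by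
            field_simp

/-- A rational point of the Legendre curve of `r ^ 4` whose abscissa is a fourth power and whose
ordinate is not zero has infinite order. -/
theorem legendre_not_isOfFinAddOrder (hr : Admissible r) {u w : ℚ} (hu : Admissible u)
    (hw : w ≠ 0) (hq : w ^ 2 = (u ^ 4 - 1) * (u ^ 4 - r ^ 4))
    {h : (twoTorsionCurve (-(1 + r ^ 4)) (r ^ 4)).Nonsingular (u ^ 4) (u ^ 2 * w)} :
    ¬ IsOfFinAddOrder (Point.some (u ^ 4) (u ^ 2 * w) h) := by
  intro hf
  have hu0 := hu.1
  have hr0 := hr.1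
  have hu1 := hu.sub_ne_zero
  have hy : u ^ 2 * w ≠ 0 := by positivity
  have hur : u ^ 4 - r ^ 4 ≠ 0 := by
    intro h0
    rw [h0, mul_zero] at hq
    exact hw (by simpa using hq)
  obtain ⟨z, hz0, hz⟩ := sq_classes_of_isOfFinAddOrder hr hu hy hf
  set t : ℚ := (u.den : ℚ) with ht
  set d : ℚ := ((r / u).den : ℚ) with hd
  have ht0 : t ≠ 0 := by rw [ht]; exact_mod_cast u.den_ne_zero
  have hd0 : d ≠ 0 := by rw [hd]; exact_mod_cast (r / u).den_ne_zero
  -- The denominators `t`, `d` have norms `1 / max 1 |u|` and `|u| / max |u| |r|`. They cancel the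
  -- maxima in the norm relation, so `κ` is a unit at all odd primes.
  set κ : ℚ := t ^ 2 * u ^ 2 * w / (d ^ 2 * (u ^ 4 - r ^ 4)) with hκ
  have hκ2 : κ ^ 2 = t ^ 4 * u ^ 4 * (u ^ 4 - 1) / (d ^ 4 * (u ^ 4 - r ^ 4)) := by
    rw [hκ, div_pow, mul_pow, hq]
    field_simp
  obtain ⟨k, hk⟩ := Rat.exists_eq_two_zpow_of_padicNorm (x := κ) (by
    intro p _ hp2
    have hpos {x : ℚ} (hx : x ≠ 0) : 0 < padicNorm p x :=
      lt_of_le_of_ne (padicNorm.nonneg x) (padicNorm.nonzero hx).symm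
    have key := padicNorm_sub_of_isOfFinAddOrder hp2 (pow_ne_zero 4 hr0) (g := r ^ 2) (by ring)
      (pow_ne_zero 4 hu0) hy hf
    have e1 : padicNorm p t ^ 4 * max 1 (padicNorm p (u ^ 4)) = 1 := by
      have := padicNorm.den_mul_max (p := p) u
      rw [padicNorm.pow, ← one_pow 4, ← max_pow_eq zero_le_one (padicNorm.nonneg _), ← mul_pow,
        this]
    have hup := hpos hu0
    have e2 : padicNorm p d ^ 4 * max (padicNorm p (u ^ 4)) (padicNorm p (r ^ 4))
        = padicNorm p (u ^ 4) := by
      have := padicNorm.den_mul_max (p := p) (r / u)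
      rw [padicNorm.div, ← div_self hup.ne', max_div_div_right hup.le, div_self hup.ne'] at this
      have h1 : padicNorm p d * max (padicNorm p u) (padicNorm p r) = padicNorm p u := by
        field_simp at this
        exact this
      rw [padicNorm.pow, padicNorm.pow, ← max_pow_eq hup.le (padicNorm.nonneg _), ← mul_pow, h1]
    have hsq : padicNorm p κ ^ 2 = 1 := by
      rw [← padicNorm.pow, hκ2, padicNorm.div, padicNorm.mul, padicNorm.mul, padicNorm.mul,
        padicNorm.pow, padicNorm.pow d]
      have p1 := hpos hur
      have p2 := hpos hd0
      have p3 := hpos ht0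
      have p4 := hpos (pow_ne_zero 4 hu0)
      have p5 := hpos hu1
      rw [div_eq_one_iff_eq (by positivity)]
      generalize padicNorm p (u ^ 4) = A at *
      generalize padicNorm p (r ^ 4) = B at *
      have m1 : 0 < max 1 A := lt_max_of_lt_left one_pos
      have m2 : 0 < max A B := lt_max_of_lt_left p4
      refine mul_right_cancel₀ (mul_pos m1 m2).ne' ?_
      linear_combination (A * padicNorm p (u ^ 4 - 1) * max A B) * e1
        - padicNorm p (u ^ 4 - r ^ 4) * max 1 A * e2 + A * key
    exact (pow_eq_one_iff_of_nonneg (padicNorm.nonneg _) two_ne_zero).1 hsq)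
  have hk2 : κ ^ 2 = 4 ^ k := by
    have : (4 : ℚ) ^ k = (2 ^ k) ^ 2 := by
      rw [show (4 : ℚ) = 2 ^ 2 by norm_num, ← zpow_natCast, ← zpow_natCast, ← zpow_mul, ← zpow_mul,
        mul_comm]
    rw [this]
    rcases hk with hk | hk <;> rw [hk]
    rw [neg_sq]
  have hF := fun z' (hz' : z' ≠ 0) => Rat.four_zpow_mul_four_sub_four_ne (a := r * d / u) (b := t)
    (z := z') (by positivity) ht0 hz' k
  -- With `κ ^ 2 = 4 ^ k`, either square condition on `z` makes the right side plus or minus a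
  -- nonzero square.
  have hval : 4 ^ k * (r * d / u) ^ 4 - t ^ 4 = t ^ 4 * u ^ 4 * (r ^ 4 - 1) / (u ^ 4 - r ^ 4) := by
    rw [← hk2, hκ2]
    field_simp
    ring
  rcases hz with hz | hz
  · refine (hF (t ^ 2 * u ^ 2 * z / w) (by positivity)).2 ?_
    rw [← neg_sub, hval, div_pow, mul_pow, hz, hq]
    field_simp
    ring
  · refine (hF (t ^ 2 * u ^ 2 * z / (u ^ 4 - r ^ 4)) (by positivity)).1 ?_
    rw [hval, div_pow, mul_pow, hz]
    field_simp

end twoTorsionCurve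

/-! ### From points of infinite order to pairs on the circle. -/

/-- Only finitely many points have their abscissa in a given finite set. -/
theorem WeierstrassCurve.Affine.Point.finite_xRep_mem {F : Type*} [Field F]
    (W : WeierstrassCurve.Affine F) {A : Set (Fin 2 → F)} (hA : A.Finite) :
    {P : W.Point | P.xRep ∈ A}.Finite := by
  refine hA.preimage' (f := fun P : W.Point => P.xRep) fun b _ => ?_
  rcases Set.eq_empty_or_nonempty ((fun P : W.Point => P.xRep) ⁻¹' {b}) with h | ⟨Q, hQ⟩
  · rw [h]
    exact Set.finite_empty
  · refine (Set.toFinite {Q, -Q}).subset fun P hP => ?_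
    have h : P.xRep = Q.xRep := hP.trans hQ.symm
    simpa using Point.eq_or_eq_neg_of_xRep_eq_xRep h

namespace twoTorsionCurve

theorem ne_zero_of_two_nsmul_ne_zero {a b x y : ℚ} {h : (twoTorsionCurve a b).Nonsingular x y}
    (hy : y ≠ 0) : 2 • Point.some x y h ≠ 0 := by
  obtain ⟨y', h', h2⟩ := add_self h hy
  rw [two_nsmul, h2]
  exact Point.some_ne_zero _

/-- A point of infinite order on the Legendre curve yields infinitely many pairs of points on the
circle. -/
theorem circlePairs_infinite {r : ℚ} (hr : Admissible r)
    {P : (twoTorsionCurve (-(1 + r ^ 4)) (r ^ 4)).Point} (hP : ¬ IsOfFinAddOrder P) :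
    (circlePairs (r ^ 2)).Infinite := by
  intro hfin
  have hinj := injective_nsmul_iff_not_isOfFinAddOrder.2 hP
  have hA := Point.finite_xRep_mem (twoTorsionCurve (-(1 + r ^ 4)) (r ^ 4))
    (hfin.image fun p => ![1 / p.1.1 ^ 2, 1])
  have hinj' : Function.Injective fun n : ℕ => (2 * (n + 1)) • P := by
    intro m n hmn
    have := hinj hmn
    lia
  refine (Set.infinite_range_of_injective hinj').mono ?_ hA
  rintro _ ⟨n, rfl⟩
  have h2 : 2 • (n + 1) • P ≠ 0 := by
    rw [smul_smul, ← zero_nsmul P]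
    intro h0
    have := hinj h0
    lia
  obtain ⟨x, y, h, s, t, v, e, hs, ht, hv⟩ := exists_sq_of_two_nsmul_ne_zero h2
  obtain ⟨hx0, -, -⟩ := ne_of_sub_eq_sq hr hs ht hv
  have hs0 : s ≠ 0 := by
    rintro rfl
    exact hx0 (by simpa using hs)
  -- Both points lie on the circle because `s ^ 2 = 1 + t ^ 2 = r ^ 4 + v ^ 2`. The pair determines
  -- the abscissa `s ^ 2` of the double, so finitely many pairs would leave finitely many doubles.
  refine ⟨((1 / s, t / s), (r ^ 2 / s, v / s)), ⟨?_, ?_, ?_, ?_⟩, ?_⟩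
  · field_simp
    linarith
  · field_simp
    linarith
  · positivity
  · field_simp
  · simp only [mul_smul, e, Point.xRep_some, hs]
    field_simp

end twoTorsionCurve

/-! ### Multiples of the base point of the quartic, and the conclusion. -/

open twoTorsionCurve

theorem Admissible.sq_ne {u : ℚ} (hu : Admissible u) (s : ℚ) :
    s ^ 2 ≠ u ^ 4 - 1 ∧ s ^ 2 ≠ -(u ^ 4 - 1) := by
  have h1 := hu.sub_ne_zero
  have hs : s ^ 2 = u ^ 4 - 1 ∨ s ^ 2 = -(u ^ 4 - 1) → s ≠ 0 := by
    rintro h rfl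
    apply h1
    rcases h with h | h <;> linarith
  constructor
  · intro h
    exact Rat.four_sub_four_ne_sq (x := u) one_ne_zero (hs (Or.inl h)) (by rw [h]; ring)
  · intro h
    exact Rat.four_sub_four_ne_sq (x := 1) hu.1 (hs (Or.inr h)) (by rw [h]; ring)

theorem Admissible.sq_ne_mul {u : ℚ} (hu : Admissible u) (s : ℚ) :
    s ^ 2 ≠ u ^ 2 * (u ^ 4 - 1) ∧ s ^ 2 ≠ -(u ^ 2 * (u ^ 4 - 1)) := by
  have hu0 := hu.1
  constructor
  · intro h
    refine (hu.sq_ne (s / u)).1 ?_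
    rw [div_pow, h]
    field_simp
  · intro h
    refine (hu.sq_ne (s / u)).2 ?_
    rw [div_pow, h]
    field_simp

namespace QuarticPoint

variable {u : ℚ}

/-- The isomorphism of the quartic with its Weierstrass model as a group homomorphism. -/
def toModelHom (u : ℚ) [hu : Fact (Admissible u)] :
    QuarticPoint u →+ (twoTorsionCurve 0 (4 * (u ^ 2 * (u ^ 4 - 1)) ^ 2)).Point where
  -- The group law is transported along the bijection, so additivity is just `toModel_ofModel`.
  toFun := toModel hu.out
  map_zero' := toModel_ofModel hu.out 0
  map_add' p q := toModel_ofModel hu.out (toModel hu.out p + toModel hu.out q)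

theorem toModelHom_injective [hu : Fact (Admissible u)] : Function.Injective (toModelHom u) :=
  (equivModel hu.out).injective

theorem toModelHom_affine [hu : Fact (Admissible u)] {r w : ℚ} {h} (hr : r ≠ u) :
    ∃ h', toModelHom u (affine r w h) = Point.some (2 * u ^ 2 * (u ^ 4 - 1) * (u + r) / (u - r))
      (4 * u ^ 3 * (u ^ 4 - 1) * w / (u - r) ^ 2) h' := by
  refine ⟨?_, ?_⟩
  swap
  · change toModel hu.out (affine r w h) = _
    rw [toModel, dif_neg hr]
    rfl

theorem two_nsmul_affine_eq_zero [hu : Fact (Admissible u)] {r : ℚ} {h} :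
    2 • (affine r 0 h : QuarticPoint u) = 0 := by
  apply toModelHom_injective
  rw [map_nsmul, map_zero]
  by_cases hr : r = u
  · have h0 : toModelHom u (affine r 0 h) = 0 := by
      subst hr
      exact map_zero (toModelHom r)
    rw [h0, nsmul_zero]
  · obtain ⟨h', e⟩ := toModelHom_affine (w := 0) (h := h) hr
    rw [e, two_nsmul]
    exact Point.add_self_of_Y_eq (by simp [negY])

theorem base_not_isOfFinAddOrder (u : ℚ) [hu : Fact (Admissible u)] :
    ¬ IsOfFinAddOrder (base u) := by
  intro hf
  have hu1 := hu.out.sub_ne_zero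
  have hu0 := hu.out.1
  have hne : u - 1 ≠ 0 := sub_ne_zero.2 hu.out.2.1
  obtain ⟨h', e⟩ := toModelHom_affine (u := u) (r := 1) (w := u ^ 4 - 1) (h := by ring)
    (Ne.symm hu.out.2.1)
  have h2 := two_nsmul_eq_zero_of_isOfFinAddOrder hu.out.sq_ne_mul ((toModelHom u).isOfFinAddOrder hf)
  refine ne_zero_of_two_nsmul_ne_zero (h := h') ?_ ?_
  · positivity
  · rw [← e]
    exact h2

theorem zsmul_base_injective (u : ℚ) [hu : Fact (Admissible u)] :
    Function.Injective fun m : ℤ => m • base u :=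
  injective_zsmul_iff_not_isOfFinAddOrder.2 (base_not_isOfFinAddOrder u)

/-- The nontrivial multiples of the base point are affine and avoid the excluded abscissae. -/
theorem exists_zsmul_base_eq_affine (u : ℚ) [hu : Fact (Admissible u)] {m : ℤ} (h0 : m ≠ 0)
    (h1 : m ≠ 1) (h2 : m ≠ -1) :
    ∃ r w h, m • base u = affine r w h ∧ Admissible r ∧ w ≠ 0 := by
  have hinj := zsmul_base_injective u
  have hu1 := hu.out.sub_ne_zero
  have hu0 := hu.out.1
  obtain ⟨r, w, h, e⟩ : ∃ r w h, m • base u = affine r w h := by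
    rcases e : m • base u with ⟨r, w, h⟩ | ⟨s, h⟩
    · exact ⟨r, w, h, rfl⟩
    · exact absurd h (hu.out.sq_ne s).2
  have hw : w ≠ 0 := by
    rintro rfl
    have h3 : (2 * m) • base u = (0 : ℤ) • base u := by
      rw [mul_smul, e, zero_zsmul]
      rw [ofNat_zsmul]
      exact two_nsmul_affine_eq_zero
    have := hinj h3
    lia
  have hru : r ≠ u := by
    rintro rfl
    apply hw
    have h3 : w ^ 2 = 0 := by rw [h]; ring
    simpa using h3
  have hu1' : (1 : ℚ) ≠ u := Ne.symm hu.out.2.1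
  have hd1 : u - 1 ≠ 0 := sub_ne_zero.2 hu.out.2.1
  have hd2 : u + 1 ≠ 0 := fun h3 => hu.out.2.2 (by linarith)
  obtain ⟨hb', eb⟩ := toModelHom_affine (u := u) (r := 1) (w := u ^ 4 - 1) (h := by ring) hu1'
  obtain ⟨h', e'⟩ := toModelHom_affine (h := h) hru
  rw [← e] at e'
  change toModelHom u (base u) = _ at eb
  -- As the base point has infinite order, `n • m • P = ±(n • P)` would force `m = ±1`.
  have hpm (n : ℕ) (hn : n ≠ 0) (h3 : toModelHom u (n • m • base u) ≠ toModelHom u (n • base u)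
      → toModelHom u (n • m • base u) ≠ -toModelHom u (n • base u) → False) : False := by
    refine h3 (fun h4 => ?_) (fun h4 => ?_)
    · have h5 : (n * m : ℤ) • base u = (n * 1 : ℤ) • base u := by
        rw [mul_smul, mul_smul, one_smul, natCast_zsmul, natCast_zsmul]
        exact toModelHom_injective h4
      have h6 : (n : ℤ) * m = n * 1 := hinj h5
      exact h1 (mul_left_cancel₀ (by exact_mod_cast hn) h6)
    · have h5 : (n * m : ℤ) • base u = (n * -1 : ℤ) • base u := by
        rw [mul_smul, mul_smul, neg_smul, one_smul, natCast_zsmul, natCast_zsmul, neg_nsmul]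
        rw [← map_neg] at h4
        exact toModelHom_injective h4
      have h6 : (n : ℤ) * m = n * -1 := hinj h5
      exact h2 (mul_left_cancel₀ (by exact_mod_cast hn) h6)
  refine ⟨r, w, h, e, ⟨?_, ?_, ?_⟩, hw⟩
  · rintro rfl
    refine (hu.out.sq_ne (w / u ^ 2)).1 ?_
    rw [div_pow, h]
    field_simp
    ring
  · rintro rfl
    refine hpm 1 one_ne_zero fun h3 h4 => ?_
    rw [one_nsmul, one_nsmul] at h3 h4
    rw [e', eb] at h3 h4
    exact (Point.X_eq_iff.1 rfl).elim h3 h4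
  -- On the model, `r = 1` and `r = -1` have abscissae with product `4 * c ^ 2`, where `c = u ^ 2 *
  -- (u ^ 4 - 1)`; up to sign such points differ by `(0, 0)`. Their doubles share an abscissa, so `n
  -- = 2` applies.
  · rintro rfl
    refine hpm 2 two_ne_zero fun h3 h4 => ?_
    rw [map_nsmul, map_nsmul, e', eb] at h3 h4
    obtain ⟨y₁, k₁, e₁⟩ := add_self hb' (by positivity)
    have hm1 : u - -1 ≠ 0 := by rwa [sub_neg_eq_add]
    obtain ⟨y₂, k₂, e₂⟩ := add_self h' (by positivity)
    rw [two_nsmul, two_nsmul, e₁, e₂] at h3 h4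
    refine (Point.X_eq_iff.1 ?_).elim h3 h4
    have hw2 : w ^ 2 = (u ^ 4 - 1) ^ 2 := by rw [h]; ring
    simp only [sub_neg_eq_add, div_pow, mul_pow, hw2]
    clear h3 h4 e₁ e₂ k₁ k₂ h' hb' e e' eb hpm
    generalize u ^ 4 - 1 = A at *
    field_simp
    ring

theorem infinite_abscissae (u : ℚ) [hu : Fact (Admissible u)] :
    {r : ℚ | ∃ m : ℤ, m ≠ 0 ∧ m ≠ 1 ∧ m ≠ -1 ∧
      ∃ w h, m • base u = affine r w h}.Infinite := by
  intro hfin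
  have hA := Point.finite_xRep_mem (twoTorsionCurve 0 (4 * (u ^ 2 * (u ^ 4 - 1)) ^ 2))
    -- The value at `r = u` is never met: the multiples considered have `w ≠ 0`.
    (hfin.image fun r => if r = u then ![1, 0] else ![2 * u ^ 2 * (u ^ 4 - 1) * (u + r) / (u - r), 1])
  have hinj : Function.Injective fun n : ℕ => toModelHom u (((n : ℤ) + 2) • base u) := by
    intro m n hmn
    have := zsmul_base_injective u (toModelHom_injective hmn)
    lia
  refine (Set.infinite_range_of_injective hinj).mono ?_ hA
  rintro _ ⟨n, rfl⟩
  obtain ⟨r, w, h, e, -, hw⟩ := exists_zsmul_base_eq_affine u (m := (n : ℤ) + 2)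
    (by lia) (by lia) (by lia)
  refine ⟨r, ⟨_, by lia, by lia, by lia, w, h, e⟩, ?_⟩
  have hru : r ≠ u := by
    rintro rfl
    apply hw
    have h3 : w ^ 2 = 0 := by rw [h]; ring
    simpa using h3
  obtain ⟨h', e'⟩ := toModelHom_affine (h := h) hru
  simp only [e, e', if_neg hru, Point.xRep_some]

end QuarticPoint

theorem legendreCurve_nonsingular {r x y : ℚ} (hr : Admissible r)
    (h : y ^ 2 = x * (x - 1) * (x - r ^ 4)) : (legendreCurve r).Nonsingular x y := by
  rw [← WeierstrassCurve.Affine.equation_iff_nonsingular_of_Δ_ne_zero]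
  · exact (legendreCurve_equation_iff r x y).2 h
  · have h1 := hr.1
    have h2 := hr.sub_ne_zero
    have h3 : (legendreCurve r).Δ = 16 * (r ^ 4 * (r ^ 4 - 1)) ^ 2 := by
      simp only [legendreCurve, WeierstrassCurve.Δ, WeierstrassCurve.b₂, WeierstrassCurve.b₄,
        WeierstrassCurve.b₆, WeierstrassCurve.b₈]
      ring
    rw [h3]
    positivity

theorem exists_zsmul_base_and_infinite (u : ℚ) [hu : Fact (Admissible u)] {m : ℤ} (h0 : m ≠ 0)
    (h1 : m ≠ 1) (h2 : m ≠ -1) :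
    ∃ r w h, m • QuarticPoint.base u = QuarticPoint.affine r w h ∧
      r ≠ 0 ∧ r ≠ 1 ∧ r ≠ -1 ∧
      (∃ hQ : (legendreCurve r).Nonsingular (u ^ 4) (u ^ 2 * w),
        ¬ IsOfFinAddOrder (WeierstrassCurve.Affine.Point.some (u ^ 4) (u ^ 2 * w) hQ)) ∧
      (circlePairs (r ^ 2)).Infinite := by
  obtain ⟨r, w, h, e, hr, hw⟩ := QuarticPoint.exists_zsmul_base_eq_affine u h0 h1 h2
  have hq : w ^ 2 = (u ^ 4 - 1) * (u ^ 4 - r ^ 4) := by rw [h]; ring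
  have hQ : (legendreCurve r).Nonsingular (u ^ 4) (u ^ 2 * w) :=
    legendreCurve_nonsingular hr (by rw [mul_pow, hq]; ring)
  have hinf := legendre_not_isOfFinAddOrder hr hu.out hw hq (h := hQ)
  exact ⟨r, w, h, e, hr.1, hr.2.1, hr.2.2, ⟨hQ, hinf⟩, circlePairs_infinite hr hinf⟩

theorem proposition1 :
    {r : ℚ | (circlePairs (r ^ 2)).Infinite}.Infinite ∧
    ∀ (u : ℚ) [Fact (Admissible u)],
      ¬ IsOfFinAddOrder (QuarticPoint.base u) ∧
      {r : ℚ | ∃ m : ℤ, m ≠ 0 ∧ m ≠ 1 ∧ m ≠ -1 ∧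
        ∃ w h, m • QuarticPoint.base u = QuarticPoint.affine r w h}.Infinite ∧
      ∀ m : ℤ, m ≠ 0 → m ≠ 1 → m ≠ -1 →
        ∃ r w h, m • QuarticPoint.base u = QuarticPoint.affine r w h ∧
          r ≠ 0 ∧ r ≠ 1 ∧ r ≠ -1 ∧
          (∃ hQ : (legendreCurve r).Nonsingular (u ^ 4) (u ^ 2 * w),
            ¬ IsOfFinAddOrder
              (WeierstrassCurve.Affine.Point.some (u ^ 4) (u ^ 2 * w) hQ)) ∧
          (circlePairs (r ^ 2)).Infinite := by
  refine ⟨?_, fun u _ => ⟨QuarticPoint.base_not_isOfFinAddOrder u, QuarticPoint.infinite_abscissae u,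
    fun m h0 h1 h2 => exists_zsmul_base_and_infinite u h0 h1 h2⟩⟩
  have : Fact (Admissible 2) := ⟨by norm_num [Admissible]⟩
  refine (QuarticPoint.infinite_abscissae 2).mono ?_
  rintro r ⟨m, h0, h1, h2, w, h, e⟩
  obtain ⟨r', w', h', e', -, -, -, -, hinf⟩ := exists_zsmul_base_and_infinite 2 h0 h1 h2
  obtain ⟨rfl, -⟩ := QuarticPoint.affine.injEq .. ▸ e.symm.trans e'
  exact hinf
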